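/- Let $d\in\{2,3\}$, let $\Omega\subset\mathbb R^d$ be a bounded polygonal domain with a finite conforming simplicial grid $\mathcal T_h$ (disjoint open $d$-simplices $K\subset\Omega$ with $\bigcup_K\overline K=\overline\Omega$, two closed elements meeting in the convex hull of their common vertices). Let $\mathcal F_h$ be the set of its faces $\Gamma$; an inner face is shared by two elements $K^-,K^+$ (in a fixed order), a boundary face belongs to one element $K^-$. Let $n$ be the unit normal on $\Gamma$ pointing away from $K^-$, $h_\Gamma=\operatorname{diam}\Gamma$; on inner faces $\langle w\rangle=\frac12(w^-+w^+)$, $[w]=w^--w^+$, on boundary faces $\langle w\rangle=[w]=w^-$. Let $\mathcal P\subset\mathbb R^p$ be compact, $f\in L^2(\Omega)$, $\nu>0$, and for $\mu\in\mathcal P$ let $\sigma_\mu\in L^\infty(\Omega)$ be scalar, bounded below by a positive constant (which may depend on $\mu$), and have one-sided traces from each adjacent element a.e. on every face (the trace at $x$ from $K$ being the limit of the averages over $B(x,r)\cap K$ as $r\to0$). Let $V_h=\{v\in L^2(\Omega): v|_K\in\mathbb P_1(K)\ \forall K\in\mathcal T_h\}$ and, for a coefficient $\sigma$, $$a_{h,\sigma}(u,v)=\sum_{K}\int_K(\sigma\nabla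 u)\cdot\nabla v\,dx+\sum_{\Gamma\in\mathcal F_h}\int_\Gamma-\langle(\sigma\nabla v)\cdot n\rangle[u]-\langle(\sigma\nabla u)\cdot n\rangle[v]+\tfrac{\nu}{h_\Gamma}[u][v]\,ds,\qquad a_{h,\mu}:=a_{h,\sigma_\mu}.$$ An IPDG solution for $\sigma$ is a $u\in V_h$ with $a_{h,\sigma}(u,v)=(f,v)_{L^2(\Omega)}$ for all $v\in V_h$. Put $H_{\rm div}(\Omega)=\{q\in L^2(\Omega)^d:\nabla\cdot q\in L^2(\Omega)\}$ with $(p,q)_{H_{\rm div}}=(p,q)_{L^2}+(\nabla\cdot p,\nabla\cdot q)_{L^2}$, and for $g\in L^2(\Omega)$ $$H_{\rm div}(\mathcal T_h,g)=\{q\in H_{\rm div}(\Omega):(\nabla\cdot q,1)_{L^2(K)}=(g,1)_{L^2(K)}\ \forall K\in\mathcal T_h\}.$$ Let $Q_h\subset H_{\rm div}(\Omega)$ be the lowest-order Raviart--Thomas--Nédélec space (fields $q|_K(x)=a_K+b_Kx$, $a_K\in\mathbb R^d$, $b_K\in\mathbb R$, with continuous normal components), and for $v\in V_h$ let $R_{h,\sigma}v\in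 Q_h$ be given by $$\int_\Gamma R_{h,\sigma}v\cdot n\,ds=\int_\Gamma-\langle(\sigma\nabla v)\cdot n\rangle+\tfrac{\nu}{h_\Gamma}[v]\,ds\quad\forall\,\Gamma\in\mathcal F_h,\qquad R_{h,\mu}:=R_{h,\sigma_\mu}.$$ Let $u_{h,f}$ be an IPDG solution for $\sigma=1$ and $t_f:=R_{h,1}u_{h,f}$. Let $\mu_1,\dots,\mu_n\in\mathcal P$ be arbitrary (for instance selected by a greedy algorithm), let $u_{h,\mu_i}$ be IPDG solutions for $\sigma_{\mu_i}$, and set $$V_n=\operatorname{span}\{u_{h,\mu_i}\}_{i\le n},\qquad Q_n=\operatorname{span}\{R_{h,\mu_i}u_{h,\mu_i}-t_f\}_{i\le n}.$$ A reduced solution for $\mu\in\mathcal P$ is a $u_{n,\mu}\in V_n$ with $a_{h,\mu}(u_{n,\mu},v)=(f,v)_{L^2(\Omega)}$ for all $v\in V_n$. For $v\in V_n$, let $\Pi_0v\in Q_n$ be given by $(\Pi_0v,q)_{H_{\rm div}}=(R_{h,\mu}v-t_f,q)_{H_{\rm div}}$ for all $q\in Q_n$. Then: 1. For $\sigma=1$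 and for $\sigma=\sigma_\mu$, $\mu\in\mathcal P$, the reconstruction $R_{h,\sigma}v$ exists and is unique for every $v\in V_h$. For every $\mu\in\mathcal P$ and every IPDG solution $u_{h,\mu}$ for $\sigma_\mu$, $R_{h,\mu}u_{h,\mu}\in H_{\rm div}(\mathcal T_h,f)$; also $t_f\in H_{\rm div}(\mathcal T_h,f)$ and $Q_n\subset H_{\rm div}(\mathcal T_h,0)$. 2. For every $\mu\in\mathcal P$, $\Pi_0v$ exists and is unique for every $v\in V_n$, and for every reduced solution $u_{n,\mu}$ the reduced flux $t_{n,\mu}:=\Pi_0u_{n,\mu}+t_f$ is locally conservative: $t_{n,\mu}\in H_{\rm div}(\mathcal T_h,f)$. 3. All required computations depend separably on $\mu$. (a) If $a_{h,\mu}=\sum_{\xi=1}^{\Xi}\theta_\xi(\mu)a_\xi$ on $V_h$ for all $\mu\in\mathcal P$ with bilinear forms $a_\xi$ independent of $\mu$, then for every finite family $(\psi_j)$ spanning $V_n$, every $\mu\in\mathcal P$ and every coefficient vector $\alpha$, $\sum_j\alpha_j\psi_j$ is a reduced solution for $\mu$ if and only if $\big(\sum_\xi\theta_\xi(\mu)A_\xi\big)\alpha=F$,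 where $(A_\xi)_{ij}=a_\xi(\psi_j,\psi_i)$, $F_i=(f,\psi_i)_{L^2(\Omega)}$. (b) If $\sigma_\mu=\sum_{\xi=1}^{\Xi}\theta_\xi(\mu)\tau_\xi$ a.e. in $\Omega$ for all $\mu\in\mathcal P$, with $\tau_\xi\in L^\infty(\Omega)$ having one-sided traces a.e. on faces as above, then there are bilinear forms $a_0,\dots,a_\Xi$ on $V_h$ and linear maps $R_0,\dots,R_\Xi:V_h\to H_{\rm div}(\Omega)$, independent of $\mu$, such that for all $\mu\in\mathcal P$ $$a_{h,\mu}=a_0+\sum_{\xi=1}^\Xi\theta_\xi(\mu)a_\xi,\qquad R_{h,\mu}=R_0+\sum_{\xi=1}^\Xi\theta_\xi(\mu)R_\xi;$$ and for all finite families $(\psi_j)$ spanning $V_n$ and $(\chi_j)$ spanning $Q_n$, all $\mu\in\mathcal P$ and all coefficient vectors $\alpha,\beta$: $\sum_j\alpha_j\psi_j$ is a reduced solution for $\mu$ if and only if $\big(A_0+\sum_\xi\theta_\xi(\mu)A_\xi\big)\alpha=F$; and $\Pi_0\big(\sum_j\alpha_j\psi_j\big)=\sum_j\beta_j\chi_j$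 if and only if $$G\beta=\Big(B_0+\sum_{\xi=1}^\Xi\theta_\xi(\mu)B_\xi\Big)\alpha-c,$$ with $(A_\xi)_{ij}=a_\xi(\psi_j,\psi_i)$, $F_i=(f,\psi_i)_{L^2(\Omega)}$, $G_{ij}=(\chi_j,\chi_i)_{H_{\rm div}}$, $(B_\xi)_{ij}=(R_\xi\psi_j,\chi_i)_{H_{\rm div}}$, $c_i=(t_f,\chi_i)_{H_{\rm div}}$. -/

import Mathlib

open MeasureTheory Filter Topology
open scoped ContDiff

noncomputable section

namespace IPDG

/-- The Euclidean space `ℝ^d`. -/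
abbrev Space (d : ℕ) := EuclideanSpace ℝ (Fin d)

/-! ### The space `H_div(Ω)` -/

/-- `L²(Ω)^d`. -/
abbrev L2Vec {d : ℕ} (Ω : Set (Space d)) := Lp (Space d) 2 (volume.restrict Ω)

/-- `L²(Ω)`. -/
abbrev L2Scal {d : ℕ} (Ω : Set (Space d)) := Lp ℝ 2 (volume.restrict Ω)

/-- Smooth test functions with compact support in `Ω`. -/
def IsTestFunction {d : ℕ} (Ω : Set (Space d)) (φ : Space d → ℝ) : Prop :=
  ContDiff ℝ ∞ φ ∧ HasCompactSupport φ ∧ tsupport φ ⊆ Ω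

/-- `g` is the weak divergence of `q` on `Ω`:
`∫_Ω q · ∇φ = - ∫_Ω g φ` for every test function `φ`. -/
def IsWeakDiv {d : ℕ} (Ω : Set (Space d)) (q : Space d → Space d) (g : Space d → ℝ) : Prop :=
  ∀ φ : Space d → ℝ, IsTestFunction Ω φ →
    ∫ x in Ω, inner ℝ (q x) (gradient φ x) = - ∫ x in Ω, g x * φ x

theorem IsTestFunction.continuous_gradient {d : ℕ} {Ω : Set (Space d)} {φ : Space d → ℝ}
    (h : IsTestFunction Ω φ) : Continuous (gradient φ) := by
  unfold gradient
  exact (InnerProductSpace.toDual ℝ (Space d)).symm.continuous.comp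
    (h.1.continuous_fderiv (by simp))

theorem IsTestFunction.hasCompactSupport_gradient {d : ℕ} {Ω : Set (Space d)}
    {φ : Space d → ℝ} (h : IsTestFunction Ω φ) : HasCompactSupport (gradient φ) :=
  (h.2.1.fderiv ℝ).comp_left
    (g := (InnerProductSpace.toDual ℝ (Space d)).symm) (by simp)

theorem IsTestFunction.integrable_inner {d : ℕ} {Ω : Set (Space d)} {φ : Space d → ℝ}
    (h : IsTestFunction Ω φ) (q : L2Vec Ω) :
    Integrable (fun x => inner ℝ (q x) (gradient φ x)) (volume.restrict Ω) := by
  have h2 : MemLp (gradient φ) 2 (volume.restrict Ω) :=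
    h.continuous_gradient.memLp_of_hasCompactSupport h.hasCompactSupport_gradient
  have := L2.integrable_inner (𝕜 := ℝ) q h2.toLp
  refine this.congr ?_
  filter_upwards [h2.coeFn_toLp] with x hx
  rw [hx]

theorem IsTestFunction.integrable_mul {d : ℕ} {Ω : Set (Space d)} {φ : Space d → ℝ}
    (h : IsTestFunction Ω φ) (g : L2Scal Ω) :
    Integrable (fun x => g x * φ x) (volume.restrict Ω) :=
  (Lp.memLp g).integrable_mul (q := 2)
    (h.1.continuous.memLp_of_hasCompactSupport h.2.1)

/-- `H_div(Ω)`: pairs of a field `q ∈ L²(Ω)^d` and its weak divergence `∇·q ∈ L²(Ω)`.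
As a subspace of the `ℓ²`-product of `L²(Ω)^d` and `L²(Ω)` it carries the inner product
`(p, q)_{H_div} = (p, q)_{L²} + (∇·p, ∇·q)_{L²}`. -/
def HDiv {d : ℕ} (Ω : Set (Space d)) : Submodule ℝ (WithLp 2 (L2Vec Ω × L2Scal Ω)) where
  carrier := {z | IsWeakDiv Ω z.fst z.snd}
  zero_mem' := by
    intro φ _
    have h1 : ∫ x in Ω, inner ℝ ((0 : L2Vec Ω) x) (gradient φ x) = 0 := by
      apply integral_eq_zero_of_ae
      filter_upwards [Lp.coeFn_zero (Space d) 2 (volume.restrict Ω)] with x hx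
      rw [hx, Pi.zero_apply, inner_zero_left, Pi.zero_apply]
    have h2 : ∫ x in Ω, (0 : L2Scal Ω) x * φ x = 0 := by
      apply integral_eq_zero_of_ae
      filter_upwards [Lp.coeFn_zero ℝ 2 (volume.restrict Ω)] with x hx
      rw [hx, Pi.zero_apply, zero_mul]
    change ∫ x in Ω, inner ℝ ((0 : L2Vec Ω) x) (gradient φ x)
      = - ∫ x in Ω, (0 : L2Scal Ω) x * φ x
    rw [h1, h2, neg_zero]
  add_mem' := by
    intro y z hy hz φ hφ
    have h1 : ∫ x in Ω, inner ℝ ((y.fst + z.fst : L2Vec Ω) x) (gradient φ x)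
        = (∫ x in Ω, inner ℝ (y.fst x) (gradient φ x))
          + ∫ x in Ω, inner ℝ (z.fst x) (gradient φ x) := by
      rw [← integral_add (hφ.integrable_inner _) (hφ.integrable_inner _)]
      apply integral_congr_ae
      filter_upwards [Lp.coeFn_add y.fst z.fst] with x hx
      rw [hx, Pi.add_apply, inner_add_left]
    have h2 : ∫ x in Ω, (y.snd + z.snd : L2Scal Ω) x * φ x
        = (∫ x in Ω, y.snd x * φ x) + ∫ x in Ω, z.snd x * φ x := by
      rw [← integral_add (hφ.integrable_mul _) (hφ.integrable_mul _)]
      apply integral_congr_ae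
      filter_upwards [Lp.coeFn_add y.snd z.snd] with x hx
      rw [hx, Pi.add_apply, add_mul]
    change ∫ x in Ω, inner ℝ ((y.fst + z.fst : L2Vec Ω) x) (gradient φ x)
      = - ∫ x in Ω, (y.snd + z.snd : L2Scal Ω) x * φ x
    rw [h1, h2, hy φ hφ, hz φ hφ, neg_add]
  smul_mem' := by
    intro c z hz φ hφ
    have h1 : ∫ x in Ω, inner ℝ ((c • z.fst : L2Vec Ω) x) (gradient φ x)
        = c * ∫ x in Ω, inner ℝ (z.fst x) (gradient φ x) := by
      rw [← integral_const_mul]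
      apply integral_congr_ae
      filter_upwards [Lp.coeFn_smul c z.fst] with x hx
      rw [hx, Pi.smul_apply, real_inner_smul_left]
    have h2 : ∫ x in Ω, (c • z.snd : L2Scal Ω) x * φ x = c * ∫ x in Ω, z.snd x * φ x := by
      rw [← integral_const_mul]
      apply integral_congr_ae
      filter_upwards [Lp.coeFn_smul c z.snd] with x hx
      rw [hx, Pi.smul_apply, smul_eq_mul, mul_assoc]
    change ∫ x in Ω, inner ℝ ((c • z.fst : L2Vec Ω) x) (gradient φ x)
      = - ∫ x in Ω, (c • z.snd : L2Scal Ω) x * φ x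
    rw [h1, h2, hz φ hφ, mul_neg]

/-- The field underlying an element of `H_div(Ω)`. -/
def HDiv.field {d : ℕ} {Ω : Set (Space d)} (q : HDiv Ω) : L2Vec Ω := q.1.fst

/-- The weak divergence of an element of `H_div(Ω)`. -/
def HDiv.div {d : ℕ} {Ω : Set (Space d)} (q : HDiv Ω) : L2Scal Ω := q.1.snd

/-! ### Simplicial grids -/

/-- The open convex hull of a vertex set; an open simplex for the vertices of a `d`-simplex. -/
def cell {d : ℕ} (K : Finset (Space d)) : Set (Space d) :=
  interior (convexHull ℝ (K : Set (Space d)))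

/-- A conforming simplicial grid of `Ω`. An element is given by its set of `d + 1` vertices; two
closed elements meet in the convex hull of their common vertices. -/
structure Mesh {d : ℕ} (Ω : Set (Space d)) where
  cells : Finset (Finset (Space d))
  card_cell : ∀ K ∈ cells, K.card = d + 1
  affineIndependent : ∀ K ∈ cells, AffineIndependent ℝ (Subtype.val : K → Space d)
  conforming : ∀ K ∈ cells, ∀ L ∈ cells,
    convexHull ℝ (K : Set (Space d)) ∩ convexHull ℝ (L : Set (Space d))
      = convexHull ℝ ((K : Set (Space d)) ∩ (L : Set (Space d)))
  cell_subset : ∀ K ∈ cells, cell K ⊆ Ω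
  iUnion_closure : ⋃ K ∈ cells, convexHull ℝ (K : Set (Space d)) = closure Ω

namespace Mesh

variable {d : ℕ} {Ω : Set (Space d)} (T : Mesh Ω)

open scoped Classical in
/-- The faces of codimension one of the elements, each given by its `d` vertices. -/
def faces : Finset (Finset (Space d)) := T.cells.biUnion (Finset.powersetCard d)

open scoped Classical in
/-- The elements adjacent to a face: two for an inner face, one for a boundary face. -/
def adjacent (Γ : T.faces) : Finset T.cells := Finset.univ.filter fun K => Γ.1 ⊆ K.1

/-- A choice, for every face `Γ`, of the adjacent element called `K⁻`. -/
structure Orientation where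
  minus : T.faces → T.cells
  subset_minus : ∀ Γ, Γ.1 ⊆ (minus Γ).1

end Mesh

/-- The surface measure (`(d-1)`-dimensional Hausdorff measure, normalised to agree with Lebesgue
measure) on the closed face with vertices `Γ`. -/
def surface {d : ℕ} (Γ : Finset (Space d)) : Measure (Space d) :=
  (Measure.euclideanHausdorffMeasure (d - 1)).restrict (convexHull ℝ (Γ : Set (Space d)))

/-- The diameter `h_Γ` of a face. -/
def faceDiam {d : ℕ} (Γ : Finset (Space d)) : ℝ :=
  Metric.diam (convexHull ℝ (Γ : Set (Space d)))

/-- The unit normal on a face `Γ` of a simplex `K` pointing out of `K`: the normalised component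
orthogonal to `Γ` of the vector from the centroid of `K` to the centroid of `Γ`. -/
def outerNormal {d : ℕ} (K Γ : Finset (Space d)) : Space d :=
  let w : Space d := (vectorSpan ℝ (Γ : Set (Space d)))ᗮ.starProjection
    (Γ.centroid ℝ id - K.centroid ℝ id)
  ‖w‖⁻¹ • w

/-! ### Traces of coefficients -/

/-- `c` is the trace at `x` of `s` seen from the element `K`: the limit of the averages of `s`
over `B(x, r) ∩ K` as `r → 0`. -/
def HasTraceAt {d : ℕ} (K : Finset (Space d)) (s : Space d → ℝ) (x : Space d) (c : ℝ) : Prop :=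
  Tendsto (fun r : ℝ => ⨍ y in Metric.ball x r ∩ cell K, s y) (𝓝[>] 0) (𝓝 c)

/-- The one-sided trace of `s` from `K`. -/
def trace {d : ℕ} (K : Finset (Space d)) (s : Space d → ℝ) (x : Space d) : ℝ :=
  limUnder (𝓝[>] (0 : ℝ)) fun r : ℝ => ⨍ y in Metric.ball x r ∩ cell K, s y

namespace Mesh

variable {d : ℕ} {Ω : Set (Space d)} (T : Mesh Ω)

/-- `s` belongs to `L^∞(Ω)` and has one-sided traces almost everywhere on all faces. -/
structure IsCoefficient (s : Space d → ℝ) : Prop where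
  memLp : MemLp s ⊤ (volume.restrict Ω)
  hasTrace : ∀ (Γ : T.faces), ∀ K ∈ T.adjacent Γ, ∀ᵐ x ∂(surface Γ.1), ∃ c, HasTraceAt K.1 s x c

/-! ### The IPDG discretisation -/

/-- The space `V_h` of functions whose restriction to every element is a polynomial of degree at
most one; such a function is the family of its restrictions `v|_K`. -/
abbrev DGSpace := T.cells → (Space d →ᵃ[ℝ] ℝ)

end Mesh

/-- The (constant) gradient of an affine function. -/
def affGrad {d : ℕ} (v : Space d →ᵃ[ℝ] ℝ) : Space d :=
  (InnerProductSpace.toDual ℝ (Space d)).symm v.linear.toContinuousLinearMap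

namespace Mesh

variable {d : ℕ} {Ω : Set (Space d)} (T : Mesh Ω)

/-- The average over a face of a quantity with a value for every element: the mean of the two
values on an inner face, the single value on a boundary face. -/
def avg (Γ : T.faces) (w : T.cells → ℝ) : ℝ :=
  ((T.adjacent Γ).card : ℝ)⁻¹ * ∑ K ∈ T.adjacent Γ, w K

open scoped Classical in
/-- The jump `w⁻ - w⁺` over an inner face; `w⁻` on a boundary face (where the sum is empty). -/
def jump (o : T.Orientation) (Γ : T.faces) (w : T.cells → ℝ) : ℝ :=
  w (o.minus Γ) - ∑ K ∈ (T.adjacent Γ).erase (o.minus Γ), w K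

/-- The normal on a face pointing away from `K⁻`. -/
def normal (o : T.Orientation) (Γ : T.faces) : Space d := outerNormal (o.minus Γ).1 Γ.1

/-- `⟨(s ∇v) · n⟩` at a point of a face. -/
def avgFlux (o : T.Orientation) (s : Space d → ℝ) (v : T.DGSpace) (Γ : T.faces)
    (x : Space d) : ℝ :=
  T.avg Γ fun K => trace K.1 s x * inner ℝ (affGrad (v K)) (T.normal o Γ)

/-- `[v]` at a point of a face. -/
def jumpAt (o : T.Orientation) (v : T.DGSpace) (Γ : T.faces) (x : Space d) : ℝ :=
  T.jump o Γ fun K => v K x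

/-- The symmetric interior penalty bilinear form for the coefficient `s`. -/
def ipForm (o : T.Orientation) (ν : ℝ) (s : Space d → ℝ) (u v : T.DGSpace) : ℝ :=
  (∑ K : T.cells, ∫ x in cell K.1, s x * inner ℝ (affGrad (u K)) (affGrad (v K)))
  + ∑ Γ : T.faces, ∫ x,
      (- T.avgFlux o s v Γ x * T.jumpAt o u Γ x - T.avgFlux o s u Γ x * T.jumpAt o v Γ x
        + ν / faceDiam Γ.1 * T.jumpAt o u Γ x * T.jumpAt o v Γ x) ∂(surface Γ.1)

/-- `(f, v)_{L²(Ω)}` for `v ∈ V_h`. -/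
def load (f : Space d → ℝ) (v : T.DGSpace) : ℝ :=
  ∑ K : T.cells, ∫ x in cell K.1, f x * v K x

/-- `u ∈ V` is the Galerkin solution in the subspace `V` of `V_h`:
`a_h(u, v) = (f, v)` for all `v ∈ V`. For `V = ⊤` it is the IPDG solution. -/
def IsGalerkinSolution (o : T.Orientation) (ν : ℝ) (s f : Space d → ℝ)
    (V : Submodule ℝ T.DGSpace) (u : T.DGSpace) : Prop :=
  u ∈ V ∧ ∀ v ∈ V, T.ipForm o ν s u v = T.load f v

/-! ### Fluxes -/

/-- The set `H_div(T_h, g)` of locally conservative fluxes. -/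
def conservative (g : Space d → ℝ) : Set (HDiv Ω) :=
  {q | ∀ K ∈ T.cells, ∫ x in cell K, HDiv.div q x = ∫ x in cell K, g x}

/-- `q` belongs to the Raviart-Thomas-Nedelec space of order zero, with
`q|_K (x) = a_K + b_K x`, where `c K = (a_K, b_K)`; its normal components are continuous. -/
structure IsRT0With (o : T.Orientation) (q : HDiv Ω) (c : T.cells → Space d × ℝ) : Prop where
  ae_eq : ∀ K : T.cells, ∀ᵐ x ∂(volume.restrict (cell K.1)),
    HDiv.field q x = (c K).1 + (c K).2 • x
  normal_continuous : ∀ Γ : T.faces, ∀ K ∈ T.adjacent Γ, ∀ L ∈ T.adjacent Γ,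
    ∀ x ∈ convexHull ℝ (Γ.1 : Set (Space d)),
      inner ℝ ((c K).1 + (c K).2 • x) (T.normal o Γ)
        = inner ℝ ((c L).1 + (c L).2 • x) (T.normal o Γ)

/-- `q ∈ Q_h` satisfies the face conditions that define the diffusive flux reconstruction of `v`:
`∫_Γ q · n = ∫_Γ - ⟨(s ∇v) · n⟩ + ν / h_Γ [v]` for every face. -/
def IsFluxReconstruction (o : T.Orientation) (ν : ℝ) (s : Space d → ℝ) (v : T.DGSpace)
    (q : HDiv Ω) : Prop :=
  ∃ c : T.cells → Space d × ℝ, T.IsRT0With o q c ∧ ∀ Γ : T.faces,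
    ∫ x, inner ℝ ((c (o.minus Γ)).1 + (c (o.minus Γ)).2 • x) (T.normal o Γ) ∂(surface Γ.1)
      = ∫ x, (- T.avgFlux o s v Γ x + ν / faceDiam Γ.1 * T.jumpAt o v Γ x) ∂(surface Γ.1)

open scoped Classical in
/-- The diffusive flux reconstruction `R_h v`: the element of `Q_h` determined by the face
conditions (the default value `0` is never used, since such an element exists uniquely). -/
def fluxReconstruction (o : T.Orientation) (ν : ℝ) (s : Space d → ℝ) (v : T.DGSpace) : HDiv Ω :=
  if h : ∃ q, T.IsFluxReconstruction o ν s v q then h.choose else 0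

end Mesh

namespace Mesh

variable {d : ℕ} {Ω : Set (Space d)} (T : Mesh Ω)

/-- The flux `t_f`: the reconstruction, for the coefficient `1`, of the IPDG solution `uf` for the
coefficient `1`. -/
def sourceFlux (o : T.Orientation) (ν : ℝ) (uf : T.DGSpace) : HDiv Ω :=
  T.fluxReconstruction o ν (fun _ => 1) uf

/-- The reduced space `V_n`, spanned by the snapshots. -/
def reducedSpace {n : ℕ} (us : Fin n → T.DGSpace) : Submodule ℝ T.DGSpace :=
  Submodule.span ℝ (Set.range us)

/-- The reduced flux space `Q_n`, spanned by the fluxes `R_{h, μ_i} u_{h, μ_i} - t_f`, where `s i`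
is the coefficient for the parameter `μ_i`. -/
def reducedFluxSpace (o : T.Orientation) (ν : ℝ) {n : ℕ} (s : Fin n → Space d → ℝ)
    (us : Fin n → T.DGSpace) (tf : HDiv Ω) : Submodule ℝ (HDiv Ω) :=
  Submodule.span ℝ (Set.range fun i => T.fluxReconstruction o ν (s i) (us i) - tf)

end Mesh

/-- `p` is the `H_div(Ω)`-orthogonal projection of `z` onto `Q`:
`p ∈ Q` and `(p, q) = (z, q)` for all `q ∈ Q`. -/
def IsProjection {d : ℕ} {Ω : Set (Space d)} (Q : Submodule ℝ (HDiv Ω)) (z p : HDiv Ω) : Prop :=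
  p ∈ Q ∧ ∀ q ∈ Q, inner ℝ p q = inner ℝ z q

end IPDG

end

/-!
Slicing a simplex by the lines parallel to an edge `a - b` reduces the divergence theorem to the
one-dimensional fundamental theorem of calculus. The sliced integral runs over the facet opposite
to `a`, and the endpoints of the slices are transported from the facet opposite to `b` by the
projection along the edge, which changes surface measure by the ratio of the gradient norms of the
barycentric coordinates. Consequently a Raviart-Thomas field with single-valued normal components
has a weak divergence, and it is determined by its normal components, which may be prescribed
freely on each face. The reconstruction `R_{h,σ} v` is the lift of the mean face fluxes of `v`.

Testing the discrete equation with the characteristic function of an element gives local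
conservation. The condition is affine, so it survives adding an element of the span `Q_n` of
differences of conservative fluxes to `t_f`. One-sided traces are limits of averages, hence linear
in the coefficient, so a separable coefficient gives a separable bilinear form and reconstruction;
the reduced problems are Galerkin problems on spans, that is, linear systems.
-/

noncomputable section

namespace IPDG

theorem inner_affGrad {d : ℕ} (l : Space d →ᵃ[ℝ] ℝ) (w : Space d) :
    inner ℝ (affGrad l) w = l.linear w :=
  InnerProductSpace.toDual_symm_apply

theorem inner_affGrad_sub {d : ℕ} (l : Space d →ᵃ[ℝ] ℝ) (x y : Space d) :
    inner ℝ (affGrad l) (x - y) = l x - l y := by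
  rw [inner_affGrad]
  exact l.linearMap_vsub x y

theorem affGrad_add {d : ℕ} (u v : Space d →ᵃ[ℝ] ℝ) : affGrad (u + v) = affGrad u + affGrad v :=
  ext_inner_right ℝ fun w => by
    simp only [inner_add_left, inner_affGrad, AffineMap.add_linear, LinearMap.add_apply]

theorem affGrad_smul {d : ℕ} (r : ℝ) (v : Space d →ᵃ[ℝ] ℝ) : affGrad (r • v) = r • affGrad v :=
  ext_inner_right ℝ fun w => by
    simp only [real_inner_smul_left, inner_affGrad, AffineMap.smul_linear, LinearMap.smul_apply,
      smul_eq_mul]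

section Slicing

variable {d : ℕ} {l : Space d →ᵃ[ℝ] ℝ} {w : Space d} {S Γ : Set (Space d)}

theorem map_add_smul_of_linear_eq_one (hw : l.linear w = 1) (x : Space d) (t : ℝ) :
    l (x + t • w) = l x + t := by
  rw [add_comm, ← vadd_eq_add, l.map_vadd, map_smul, hw, smul_eq_mul, mul_one, vadd_eq_add,
    add_comm]

theorem affGrad_ne_zero_of_linear_eq_one (hw : l.linear w = 1) : affGrad l ≠ 0 := by
  rintro h
  simpa [h, hw] using inner_affGrad l w

theorem volume_eq_lintegral_level (hw : l.linear w = 1) (hS : MeasurableSet S) :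
    volume S = ‖affGrad l‖ₑ⁻¹ * ∫⁻ t : ℝ, μHE[d - 1] (S ∩ {x | l x = t}) := by
  have hg := affGrad_ne_zero_of_linear_eq_one hw
  have hnorm : ‖affGrad l‖ ≠ 0 := norm_ne_zero_iff.2 hg
  set v := (‖affGrad l‖ ^ 2)⁻¹ • affGrad l with hv
  have hv0 : v ≠ 0 := smul_ne_zero (by positivity) hg
  have hlv : l.linear v = 1 := by
    rw [← inner_affGrad, hv, real_inner_smul_right, real_inner_self_eq_norm_sq,
      inv_mul_cancel₀ (by positivity)]
  have hlevel (t : ℝ) : (AffineSubspace.mk' (t • v +ᵥ (-(l 0)) • v) (ℝ ∙ v)ᗮ : Set (Space d))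
      = {x | l x = t} := by
    ext x
    have hp : l (t • v +ᵥ (-(l 0)) • v) = t := by
      have := map_add_smul_of_linear_eq_one hlv 0 (t + -l 0)
      rw [vadd_eq_add, ← add_smul, ← zero_add (_ • v), this]
      ring
    rw [SetLike.mem_coe, AffineSubspace.mem_mk', Submodule.mem_orthogonal_singleton_iff_inner_right,
      hv, real_inner_smul_left, vsub_eq_sub, inner_affGrad_sub, ← hv, hp, mul_eq_zero_iff_left
      (by positivity), sub_eq_zero, Set.mem_ofPred_eq]
  have hnv : ‖v‖ₑ = ‖affGrad l‖ₑ⁻¹ := by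
    rw [← ofReal_norm, ← ofReal_norm, ← ENNReal.ofReal_inv_of_pos (by positivity), hv, norm_smul,
      norm_inv, norm_pow, norm_norm]
    congr 1
    field_simp
  have := EuclideanGeometry.euclideanHausdorffMeasure_eq_lintegral ((-(l 0)) • v) hv0 hS
  rw [InnerProductSpace.euclideanHausdorffMeasure_eq_volume, hnv] at this
  simp_rw [this, hlevel, finrank_euclideanSpace_fin]

theorem volume_eq_lintegral_translate (hw : l.linear w = 1) (hS : MeasurableSet S) :
    volume S = ‖affGrad l‖ₑ⁻¹ * ∫⁻ t : ℝ, μHE[d - 1] {z | l z = 0 ∧ z + t • w ∈ S} := by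
  have hslice (t : ℝ) : {z | l z = 0 ∧ z + t • w ∈ S}
      = (fun z => z + t • w) ⁻¹' (S ∩ {x | l x = t}) := by
    ext z
    simp [map_add_smul_of_linear_eq_one hw, and_comm]
  simp_rw [hslice, measure_preimage_add_right]
  exact volume_eq_lintegral_level hw hS

theorem volume_prism (hw : l.linear w = 1) (hΓ : MeasurableSet Γ) (hΓl : ∀ z ∈ Γ, l z = 0) :
    volume {x | l x ∈ Set.Icc 0 1 ∧ x - l x • w ∈ Γ} = ‖affGrad l‖ₑ⁻¹ * μHE[d - 1] Γ := by
  have hl := l.continuous_of_finiteDimensional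
  have hS : MeasurableSet {x | l x ∈ Set.Icc 0 1 ∧ x - l x • w ∈ Γ} :=
    (measurableSet_Icc.preimage hl.measurable).inter
      (hΓ.preimage (continuous_id.sub (hl.smul continuous_const)).measurable)
  have hslice (t : ℝ) : μHE[d - 1] {z | l z = 0 ∧ z + t • w ∈ {x | l x ∈ Set.Icc 0 1 ∧
      x - l x • w ∈ Γ}} = (Set.Icc 0 1).indicator (fun _ => μHE[d - 1] Γ) t := by
    by_cases ht : t ∈ Set.Icc (0 : ℝ) 1
    · rw [Set.indicator_of_mem ht]
      congr 1
      ext z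
      constructor
      · rintro ⟨hz, -, hzΓ⟩
        simpa [map_add_smul_of_linear_eq_one hw, hz] using hzΓ
      · intro hz
        simpa [map_add_smul_of_linear_eq_one hw, hΓl z hz, hz] using ht
    · rw [Set.indicator_of_notMem ht]
      convert measure_empty (μ := μHE[d - 1])
      rw [Set.eq_empty_iff_forall_notMem]
      rintro z ⟨hz, hzt, -⟩
      rw [map_add_smul_of_linear_eq_one hw, hz, zero_add] at hzt
      exact ht hzt
  rw [volume_eq_lintegral_translate hw hS]
  simp_rw [hslice, lintegral_indicator_const measurableSet_Icc]
  simp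

theorem map_prod_add_smul (hw : l.linear w = 1) (hΓ : MeasurableSet Γ) (hΓl : ∀ z ∈ Γ, l z = 0)
    [SFinite (μHE[d - 1].restrict Γ)] :
    ((μHE[d - 1].restrict Γ).prod volume).map (fun p : Space d × ℝ => p.1 + p.2 • w)
      = ‖affGrad l‖ₑ • volume.restrict {x | x - l x • w ∈ Γ} := by
  have hl := l.continuous_of_finiteDimensional
  have hadd : Measurable fun p : Space d × ℝ => p.1 + p.2 • w :=
    (continuous_fst.add (continuous_snd.smul continuous_const)).measurable
  have hN : MeasurableSet {x | x - l x • w ∈ Γ} :=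
    hΓ.preimage (continuous_id.sub (hl.smul continuous_const)).measurable
  ext S hS
  rw [Measure.map_apply hadd hS, Measure.prod_apply_symm (hS.preimage hadd), Measure.smul_apply,
    Measure.restrict_apply hS, volume_eq_lintegral_translate hw (hS.inter hN), smul_eq_mul,
    ← mul_assoc, ENNReal.mul_inv_cancel (by simpa using affGrad_ne_zero_of_linear_eq_one hw)
    enorm_ne_top, one_mul]
  refine lintegral_congr fun t => ?_
  rw [Measure.restrict_apply ((hS.preimage hadd).preimage measurable_prodMk_right)]
  congr 1
  ext z
  constructor
  · rintro ⟨hzS, hz⟩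
    exact ⟨hΓl z hz, hzS, by simpa [map_add_smul_of_linear_eq_one hw, hΓl z hz] using hz⟩
  · rintro ⟨hz, hzS, hzΓ⟩
    exact ⟨hzS, by simpa [map_add_smul_of_linear_eq_one hw, hz] using hzΓ⟩

end Slicing

theorem prod_volume_apply_of_fiber {α : Type*} [MeasurableSpace α] {η : Measure α} {B : Set α}
    {S : Set (α × ℝ)} (hB : MeasurableSet B) (hS : MeasurableSet S)
    (hfiber : ∀ᵐ z ∂η, volume (Prod.mk z ⁻¹' S) = B.indicator 1 z) : η.prod volume S = η B := by
  rw [Measure.prod_apply hS]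
  exact (lintegral_congr_ae hfiber).trans (lintegral_indicator_one hB)

theorem volume_slab {d : ℕ} {l κ : Space d →ᵃ[ℝ] ℝ} {w : Space d} {Γ : Set (Space d)}
    (hw : l.linear w = 1) (hΓ : MeasurableSet Γ) (hΓl : ∀ z ∈ Γ, l z = 0)
    [SFinite (μHE[d - 1].restrict Γ)] (hκ : |κ.linear w| = 1) :
    volume {x | κ x ∈ Set.Icc 0 1 ∧ x - l x • w ∈ Γ} = ‖affGrad l‖ₑ⁻¹ * μHE[d - 1] Γ := by
  have hcont := κ.continuous_of_finiteDimensional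
  have hadd : Measurable fun p : Space d × ℝ => p.1 + p.2 • w :=
    (continuous_fst.add (continuous_snd.smul continuous_const)).measurable
  have hS : MeasurableSet (κ ⁻¹' Set.Icc 0 1) := measurableSet_Icc.preimage hcont.measurable
  have hslab (z : Space d) : volume {t : ℝ | κ (z + t • w) ∈ Set.Icc 0 1} = 1 := by
    have hline (t : ℝ) : κ (z + t • w) = κ z + t * κ.linear w := by
      rw [add_comm z, ← vadd_eq_add, κ.map_vadd, map_smul, smul_eq_mul, vadd_eq_add, add_comm]
    simp_rw [hline]
    obtain h | h := eq_or_eq_neg_of_abs_eq hκ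
    · have : {t : ℝ | κ z + t * κ.linear w ∈ Set.Icc 0 1} = Set.Icc (-κ z) (1 - κ z) := by
        ext t
        simp only [h, Set.mem_ofPred_eq, Set.mem_Icc]
        constructor <;> rintro ⟨_, _⟩ <;> constructor <;> linarith
      rw [this, Real.volume_Icc]
      norm_num
    · have : {t : ℝ | κ z + t * κ.linear w ∈ Set.Icc 0 1} = Set.Icc (κ z - 1) (κ z) := by
        ext t
        simp only [h, Set.mem_ofPred_eq, Set.mem_Icc]
        constructor <;> rintro ⟨_, _⟩ <;> constructor <;> linarith
      rw [this, Real.volume_Icc]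
      norm_num
  have hprod := congrArg (· (κ ⁻¹' Set.Icc 0 1)) (map_prod_add_smul hw hΓ hΓl)
  simp only [Measure.map_apply hadd hS, Measure.smul_apply, Measure.restrict_apply hS,
    smul_eq_mul] at hprod
  rw [prod_volume_apply_of_fiber MeasurableSet.univ (hS.preimage hadd)
    (.of_forall fun z => (hslab z).trans (by simp)), Measure.restrict_apply_univ] at hprod
  rw [hprod, ENNReal.inv_mul_cancel_left
    (enorm_ne_zero.2 (affGrad_ne_zero_of_linear_eq_one hw)) enorm_ne_top]
  rfl

theorem isCompact_convexHull_finset {d : ℕ} (K : Finset (Space d)) :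
    IsCompact (convexHull ℝ (K : Set (Space d))) :=
  K.finite_toSet.isCompact_convexHull ℝ

theorem measurableSet_convexHull_finset {d : ℕ} (K : Finset (Space d)) :
    MeasurableSet (convexHull ℝ (K : Set (Space d))) :=
  (isCompact_convexHull_finset K).measurableSet

theorem cell_ae_eq {d : ℕ} (K : Finset (Space d)) :
    cell K =ᵐ[volume] convexHull ℝ (K : Set (Space d)) :=
  interior_ae_eq_of_null_frontier ((convex_convexHull ℝ _).addHaar_frontier volume)

theorem ae_surface_mem {d : ℕ} (Γ : Finset (Space d)) :
    ∀ᵐ x ∂(surface Γ), x ∈ convexHull ℝ (Γ : Set (Space d)) :=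
  ae_restrict_mem (measurableSet_convexHull_finset Γ)

open scoped Classical in
/-- The facet of the simplex `K` opposite to its vertex `a`, given by its vertices. -/
def facet {d : ℕ} (K : Finset (Space d)) (a : K) : Finset (Space d) := K.erase a

theorem mem_facet {d : ℕ} {K : Finset (Space d)} {a : K} {x : Space d} :
    x ∈ facet K a ↔ x ≠ a ∧ x ∈ K := by
  classical exact Finset.mem_erase

theorem vertex_mem_facet {d : ℕ} {K : Finset (Space d)} {a b : K} (h : b ≠ a) :
    (b : Space d) ∈ facet K a :=
  mem_facet.2 ⟨Subtype.coe_ne_coe.2 h, b.2⟩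

/-- `K` is the vertex set of a nondegenerate simplex of full dimension. -/
structure IsSimplex {d : ℕ} (K : Finset (Space d)) : Prop where
  card_eq : K.card = d + 1
  indep : AffineIndependent ℝ (Subtype.val : K → Space d)

namespace IsSimplex

variable {d : ℕ} {K : Finset (Space d)}

/-- The vertices of a simplex as an affine basis; `hK.basis.coord` are the barycentric
coordinates. -/
def basis (hK : IsSimplex K) : AffineBasis K ℝ (Space d) where
  toFun := Subtype.val
  ind' := hK.indep
  tot' := by
    rw [hK.indep.affineSpan_eq_top_iff_card_eq_finrank_add_one]
    simp [hK.card_eq]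

@[simp]
theorem basis_apply (hK : IsSimplex K) (a : K) : hK.basis a = a := rfl

theorem range_basis (hK : IsSimplex K) : Set.range hK.basis = (K : Set (Space d)) :=
  Subtype.range_coe

/-- The gradient of the barycentric coordinate of the vertex `a`. -/
def grad (hK : IsSimplex K) (a : K) : Space d := affGrad (hK.basis.coord a)

theorem nonempty (hK : IsSimplex K) : Nonempty K := by
  rw [← Fintype.card_pos_iff, Fintype.card_coe, hK.card_eq]
  exact d.succ_pos

theorem exists_ne (hK : IsSimplex K) (hd : 0 < d) (a : K) : ∃ b : K, b ≠ a :=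
  Fintype.exists_ne_of_one_lt_card (by simp [hK.card_eq, hd]) a

theorem coord_self (hK : IsSimplex K) (a : K) : hK.basis.coord a a = 1 :=
  hK.basis.coord_apply_eq a

theorem coord_of_ne (hK : IsSimplex K) {a b : K} (h : a ≠ b) : hK.basis.coord a b = 0 :=
  hK.basis.coord_apply_ne h

theorem linear_coord_self (hK : IsSimplex K) {a b : K} (h : a ≠ b) :
    (hK.basis.coord a).linear (a - b) = 1 := by
  rw [← inner_affGrad, inner_affGrad_sub, hK.coord_self, hK.coord_of_ne h, sub_zero]

theorem inner_grad_sub (hK : IsSimplex K) (a : K) (x y : Space d) :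
    inner ℝ (hK.grad a) (x - y) = hK.basis.coord a x - hK.basis.coord a y :=
  inner_affGrad_sub _ _ _

theorem grad_ne_zero (hK : IsSimplex K) (hd : 0 < d) (a : K) : hK.grad a ≠ 0 := by
  obtain ⟨b, hb⟩ := hK.exists_ne hd a
  exact affGrad_ne_zero_of_linear_eq_one (hK.linear_coord_self hb.symm)

theorem norm_grad_ne_zero (hK : IsSimplex K) (hd : 0 < d) (a : K) : ‖hK.grad a‖ ≠ 0 :=
  norm_ne_zero_iff.2 (hK.grad_ne_zero hd a)

theorem sum_inner_grad_smul (hK : IsSimplex K) (w : Space d) :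
    ∑ a : K, inner ℝ (hK.grad a) w • (a : Space d) = w := by
  have hw := hK.basis.linear_combination_coord_eq_self w
  have h0 := hK.basis.linear_combination_coord_eq_self 0
  calc ∑ a : K, inner ℝ (hK.grad a) w • (a : Space d)
      = ∑ a : K, (hK.basis.coord a w - hK.basis.coord a 0) • (a : Space d) := by
        simp_rw [← hK.inner_grad_sub, sub_zero]
    _ = w := by
        simp only [basis_apply] at hw h0
        rw [← sub_zero w]
        simp only [sub_smul, Finset.sum_sub_distrib, hw, h0, sub_zero]

theorem sum_inner_grad (hK : IsSimplex K) (w : Space d) :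
    ∑ a : K, inner ℝ (hK.grad a) w = 0 := by
  calc ∑ a : K, inner ℝ (hK.grad a) w
      = ∑ a : K, (hK.basis.coord a w - hK.basis.coord a 0) := by
        simp_rw [← hK.inner_grad_sub, sub_zero]
    _ = 0 := by
        simp_rw [Finset.sum_sub_distrib, hK.basis.sum_coord_apply_eq_one, sub_self]

theorem sum_inner_grad_smul_sub (hK : IsSimplex K) (x w : Space d) :
    ∑ a : K, inner ℝ (hK.grad a) w • ((a : Space d) - x) = w := by
  simp_rw [smul_sub, Finset.sum_sub_distrib, hK.sum_inner_grad_smul, ← Finset.sum_smul,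
    hK.sum_inner_grad, zero_smul, sub_zero]

theorem mem_convexHull_iff (hK : IsSimplex K) {x : Space d} :
    x ∈ convexHull ℝ (K : Set (Space d)) ↔ ∀ a, 0 ≤ hK.basis.coord a x := by
  rw [← hK.range_basis, hK.basis.convexHull_eq_nonneg_coord, Set.mem_ofPred_eq]

theorem mem_cell_iff (hK : IsSimplex K) {x : Space d} :
    x ∈ cell K ↔ ∀ a, 0 < hK.basis.coord a x := by
  rw [cell, ← hK.range_basis, hK.basis.interior_convexHull, Set.mem_ofPred_eq]

theorem centroid_mem_cell (hK : IsSimplex K) : K.centroid ℝ id ∈ cell K := by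
  rw [hK.mem_cell_iff, ← Finset.centroid_univ]
  intro a
  have := hK.nonempty
  have hcoord := hK.basis.coord_apply_centroid (Finset.mem_univ a)
  exact hcoord ▸ inv_pos.2 (by exact_mod_cast Finset.card_pos.2 Finset.univ_nonempty)

theorem mem_convexHull_facet_iff (hK : IsSimplex K) {a : K} {x : Space d} :
    x ∈ convexHull ℝ (facet K a : Set (Space d))
      ↔ hK.basis.coord a x = 0 ∧ ∀ b, 0 ≤ hK.basis.coord b x := by
  classical
  constructor
  · intro hx
    have hzero : (facet K a : Set (Space d)) ⊆ {y | hK.basis.coord a y = 0} := fun y hy => by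
      obtain ⟨hne, hyK⟩ := mem_facet.1 hy
      exact hK.coord_of_ne (b := ⟨y, hyK⟩) fun h => hne (congrArg Subtype.val h).symm
    have hconv : Convex ℝ {y | hK.basis.coord a y = 0} :=
      (convex_singleton (0 : ℝ)).affine_preimage (hK.basis.coord a)
    exact ⟨convexHull_min hzero hconv hx, hK.mem_convexHull_iff.1
      (convexHull_mono (fun y hy => (mem_facet.1 hy).2) hx)⟩
  · rintro ⟨hxa, hx⟩
    rw [← hK.basis.linear_combination_coord_eq_self x,
      ← Finset.sum_erase (a := a) _ (by simp [hxa])]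
    refine (convex_convexHull ℝ _).sum_mem (fun b _ => hx b) ?_ fun b hb =>
      subset_convexHull ℝ _ (vertex_mem_facet (Finset.ne_of_mem_erase hb))
    rw [Finset.sum_erase (f := fun b => hK.basis.coord b x) _ hxa, hK.basis.sum_coord_apply_eq_one]

theorem coord_eq_zero_of_mem_facet (hK : IsSimplex K) {a : K} {x : Space d}
    (hx : x ∈ convexHull ℝ (facet K a : Set (Space d))) : hK.basis.coord a x = 0 :=
  (hK.mem_convexHull_facet_iff.1 hx).1

theorem vectorSpan_facet (hK : IsSimplex K) (hd : 0 < d) (a : K) :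
    vectorSpan ℝ (facet K a : Set (Space d)) = (ℝ ∙ hK.grad a)ᗮ := by
  classical
  obtain ⟨m, rfl⟩ : ∃ m, d = m + 1 := ⟨d - 1, by omega⟩
  refine Submodule.eq_of_le_of_finrank_eq ?_ ?_
  · rw [vectorSpan_def, Submodule.span_le]
    rintro _ ⟨x, hx, y, hy, rfl⟩
    beta_reduce
    rw [SetLike.mem_coe, Submodule.mem_orthogonal_singleton_iff_inner_right, vsub_eq_sub,
      hK.inner_grad_sub, hK.coord_eq_zero_of_mem_facet (subset_convexHull ℝ _ hx),
      hK.coord_eq_zero_of_mem_facet (subset_convexHull ℝ _ hy), sub_self]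
  · have : Fact (Module.finrank ℝ (Space (m + 1)) = m + 1) := ⟨finrank_euclideanSpace_fin⟩
    have hindep : AffineIndependent ℝ (Subtype.val : facet K a → Space (m + 1)) :=
      hK.indep.mono fun x hx => (mem_facet.1 hx).2
    have hcard : Fintype.card (facet K a) = m + 1 := by
      rw [Fintype.card_coe, facet, Finset.card_erase_of_mem a.2, hK.card_eq, Nat.add_sub_cancel]
    rw [Submodule.finrank_orthogonal_span_singleton (n := m) (hK.grad_ne_zero hd a)]
    have hrange : Set.range (Subtype.val : facet K a → Space (m + 1)) = facet K a :=
      Subtype.range_coe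
    exact hrange ▸ hindep.finrank_vectorSpan hcard

theorem facet_nonempty (hK : IsSimplex K) (hd : 0 < d) (a : K) : (facet K a).Nonempty := by
  obtain ⟨b, hb⟩ := hK.exists_ne hd a
  exact ⟨b, vertex_mem_facet hb⟩

theorem centroid_facet_mem (hK : IsSimplex K) (hd : 0 < d) (a : K) :
    (facet K a).centroid ℝ id ∈ convexHull ℝ (facet K a : Set (Space d)) :=
  Finset.centroid_mem_convexHull _ (hK.facet_nonempty hd a)

theorem outerNormal_facet (hK : IsSimplex K) (hd : 0 < d) (a : K) :
    outerNormal K (facet K a) = -(‖hK.grad a‖⁻¹ • hK.grad a) := by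
  have hg := hK.norm_grad_ne_zero hd a
  set g := hK.grad a with hg_def
  set u := (facet K a).centroid ℝ id - K.centroid ℝ id with hu
  have hgu : inner ℝ g u < 0 := by
    rw [hg_def, hu, hK.inner_grad_sub, hK.coord_eq_zero_of_mem_facet (hK.centroid_facet_mem hd a),
      zero_sub, neg_lt_zero]
    exact hK.mem_cell_iff.1 hK.centroid_mem_cell a
  have hproj : (vectorSpan ℝ (facet K a : Set (Space d)))ᗮ.starProjection u
      = (inner ℝ g u / ‖g‖ ^ 2) • g := by
    simp only [hK.vectorSpan_facet hd, Submodule.orthogonal_orthogonal]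
    exact Submodule.starProjection_singleton ℝ u
  have ht : inner ℝ g u / ‖g‖ ^ 2 < 0 := div_neg_of_neg_of_pos hgu (by positivity)
  rw [outerNormal, hproj, norm_smul, Real.norm_of_nonpos ht.le, smul_smul, ← neg_smul]
  congr 1
  field_simp
  rw [div_self hgu.ne]

theorem inner_sub_outerNormal (hK : IsSimplex K) (hd : 0 < d) (a : K) (x y : Space d) :
    inner ℝ (x - y) (outerNormal K (facet K a))
      = -(‖hK.grad a‖⁻¹ * (hK.basis.coord a x - hK.basis.coord a y)) := by
  rw [hK.outerNormal_facet hd, inner_neg_right, real_inner_smul_right, real_inner_comm,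
    hK.inner_grad_sub]

theorem norm_outerNormal (hK : IsSimplex K) (hd : 0 < d) (a : K) :
    ‖outerNormal K (facet K a)‖ = 1 := by
  rw [hK.outerNormal_facet hd, norm_neg, norm_smul, norm_inv, norm_norm,
    inv_mul_cancel₀ (hK.norm_grad_ne_zero hd a)]

/-- The union of the lines in direction `a - b` that meet the simplex. -/
def edgeTube (hK : IsSimplex K) (a b : K) : Set (Space d) :=
  {x | (∀ c, c ≠ a → c ≠ b → 0 ≤ hK.basis.coord c x) ∧
    0 ≤ hK.basis.coord a x + hK.basis.coord b x}

theorem edgeTube_comm (hK : IsSimplex K) (a b : K) : hK.edgeTube a b = hK.edgeTube b a := by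
  ext x
  simp only [edgeTube, Set.mem_ofPred_eq, add_comm (hK.basis.coord a x)]
  exact and_congr_left' (forall_congr' fun c => imp.swap)

theorem coord_add_smul_sub_left (hK : IsSimplex K) {a b : K} (hab : a ≠ b) (x : Space d) (t : ℝ) :
    hK.basis.coord a (x + t • ((a : Space d) - b)) = hK.basis.coord a x + t :=
  map_add_smul_of_linear_eq_one (hK.linear_coord_self hab) x t

theorem coord_add_smul_sub_right (hK : IsSimplex K) {a b : K} (hab : a ≠ b) (x : Space d)
    (t : ℝ) : hK.basis.coord b (x + t • ((a : Space d) - b)) = hK.basis.coord b x - t := by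
  rw [← neg_sub (b : Space d), smul_neg, ← neg_smul, hK.coord_add_smul_sub_left hab.symm,
    sub_eq_add_neg]

theorem coord_add_smul_sub_of_ne (hK : IsSimplex K) {a b c : K} (hca : c ≠ a) (hcb : c ≠ b)
    (x : Space d) (t : ℝ) :
    hK.basis.coord c (x + t • ((a : Space d) - b)) = hK.basis.coord c x := by
  have h := hK.inner_grad_sub c (x + t • ((a : Space d) - b)) x
  have hzero := hK.inner_grad_sub c a b
  rw [hK.coord_of_ne hca, hK.coord_of_ne hcb, sub_self] at hzero
  rw [add_sub_cancel_left, real_inner_smul_right, hzero, mul_zero] at h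
  linarith

/-- The projection in direction `a - b` onto the hyperplane of the facet opposite to `a`. -/
def edgeProj (hK : IsSimplex K) (a b : K) (x : Space d) : Space d :=
  x - hK.basis.coord a x • ((a : Space d) - b)

theorem measurable_edgeProj (hK : IsSimplex K) (a b : K) : Measurable (hK.edgeProj a b) :=
  (continuous_id.sub ((hK.basis.coord a).continuous_of_finiteDimensional.smul
    continuous_const)).measurable

theorem edgeProj_swap (hK : IsSimplex K) (a b : K) (x : Space d) :
    hK.edgeProj b a x = x + hK.basis.coord b x • ((a : Space d) - b) := by
  rw [edgeProj]
  module

theorem edgeProj_edgeProj_swap (hK : IsSimplex K) {a b : K} (hab : a ≠ b) (x : Space d) :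
    hK.edgeProj a b (hK.edgeProj b a x) = hK.edgeProj a b x := by
  rw [hK.edgeProj_swap a b, edgeProj, edgeProj, hK.coord_add_smul_sub_left hab]
  module

theorem edgeProj_mem_facet_iff (hK : IsSimplex K) {a b : K} (hab : a ≠ b) {x : Space d} :
    hK.edgeProj a b x ∈ convexHull ℝ (facet K a : Set (Space d)) ↔ x ∈ hK.edgeTube a b := by
  rw [edgeProj, sub_eq_add_neg, ← neg_smul, hK.mem_convexHull_facet_iff]
  constructor
  · rintro ⟨-, h⟩
    refine ⟨fun c hca hcb => ?_, ?_⟩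
    · rw [← hK.coord_add_smul_sub_of_ne hca hcb]
      exact h c
    · rw [add_comm, ← sub_neg_eq_add, ← hK.coord_add_smul_sub_right hab]
      exact h b
  · rintro ⟨hother, hsum⟩
    refine ⟨by rw [hK.coord_add_smul_sub_left hab, add_neg_cancel], fun c => ?_⟩
    obtain rfl | hca := eq_or_ne c a
    · rw [hK.coord_add_smul_sub_left hab, add_neg_cancel]
    obtain rfl | hcb := eq_or_ne c b
    · rwa [hK.coord_add_smul_sub_right hab, sub_neg_eq_add, add_comm]
    · rw [hK.coord_add_smul_sub_of_ne hca hcb]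
      exact hother c hca hcb

theorem mem_convexHull_iff_mem_edgeTube (hK : IsSimplex K) {a b : K} {x : Space d} :
    x ∈ convexHull ℝ (K : Set (Space d)) ↔
      x ∈ hK.edgeTube a b ∧ 0 ≤ hK.basis.coord a x ∧ 0 ≤ hK.basis.coord b x := by
  rw [hK.mem_convexHull_iff]
  refine ⟨fun h => ⟨⟨fun c _ _ => h c, add_nonneg (h a) (h b)⟩, h a, h b⟩, ?_⟩
  rintro ⟨⟨hother, -⟩, ha, hb⟩ c
  by_cases hca : c = a
  · exact hca ▸ ha
  by_cases hcb : c = b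
  · exact hcb ▸ hb
  exact hother c hca hcb

theorem coord_le_one (hK : IsSimplex K) {x : Space d} (hx : x ∈ convexHull ℝ (K : Set (Space d)))
    (a : K) : hK.basis.coord a x ≤ 1 := by
  rw [← hK.basis.sum_coord_apply_eq_one x]
  exact Finset.single_le_sum (f := fun b => hK.basis.coord b x)
    (fun b _ => hK.mem_convexHull_iff.1 hx b) (Finset.mem_univ a)

/-- The prism in direction `a - b` over the facet opposite to `a` that contains the simplex. -/
def prism (hK : IsSimplex K) (a b : K) : Set (Space d) :=
  {x | hK.basis.coord a x ∈ Set.Icc 0 1 ∧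
    hK.edgeProj a b x ∈ convexHull ℝ (facet K a : Set (Space d))}

theorem volume_prism (hK : IsSimplex K) {a b : K} (hab : a ≠ b) :
    volume (hK.prism a b)
      = ‖hK.grad a‖ₑ⁻¹ * μHE[d - 1] (convexHull ℝ (facet K a : Set (Space d))) :=
  IPDG.volume_prism (hK.linear_coord_self hab) (measurableSet_convexHull_finset _) fun _ hz =>
    hK.coord_eq_zero_of_mem_facet hz

theorem volume_prism_ne_top (hK : IsSimplex K) (a b : K) : volume (hK.prism a b) ≠ ⊤ := by
  have hcompact : IsCompact ((fun p : Space d × ℝ => p.1 + p.2 • ((a : Space d) - b)) ''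
      (convexHull ℝ (facet K a : Set (Space d)) ×ˢ Set.Icc 0 1)) :=
    ((isCompact_convexHull_finset _).prod isCompact_Icc).image (by fun_prop)
  refine ne_top_of_le_ne_top hcompact.measure_ne_top (measure_mono fun x hx => ?_)
  exact ⟨(_, hK.basis.coord a x), ⟨hx.2, hx.1⟩, sub_add_cancel _ _⟩

theorem volume_prism_ne_zero (hK : IsSimplex K) {a b : K} (hab : a ≠ b) :
    volume (hK.prism a b) ≠ 0 := by
  have hsub : cell K ⊆ hK.prism a b := fun x hx => by
    have hx' := interior_subset hx
    exact ⟨⟨hK.mem_convexHull_iff.1 hx' a, hK.coord_le_one hx' a⟩,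
      (hK.edgeProj_mem_facet_iff hab).2 (hK.mem_convexHull_iff_mem_edgeTube.1 hx').1⟩
  have hpos : 0 < volume (cell K) :=
    isOpen_interior.measure_pos volume ⟨_, hK.centroid_mem_cell⟩
  exact (hpos.trans_le (measure_mono hsub)).ne'

theorem surface_facet_univ (hK : IsSimplex K) {a b : K} (hab : a ≠ b) :
    surface (facet K a) Set.univ = ‖hK.grad a‖ₑ * volume (hK.prism a b) := by
  rw [hK.volume_prism hab, ← mul_assoc, ENNReal.mul_inv_cancel _ enorm_ne_top, one_mul, surface,
    Measure.restrict_apply_univ]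
  exact enorm_ne_zero.2 (affGrad_ne_zero_of_linear_eq_one (hK.linear_coord_self hab))

theorem isFiniteMeasure_surface (hK : IsSimplex K) (a : K) :
    IsFiniteMeasure (surface (facet K a)) := by
  refine ⟨?_⟩
  by_cases h : ∃ b, b ≠ a
  · obtain ⟨b, hb⟩ := h
    rw [hK.surface_facet_univ hb.symm]
    exact ENNReal.mul_lt_top enorm_lt_top (hK.volume_prism_ne_top a b).lt_top
  · have hempty : facet K a = ∅ := Finset.eq_empty_of_forall_notMem fun x hx =>
      h ⟨⟨x, (mem_facet.1 hx).2⟩, fun hxa => (mem_facet.1 hx).1 (congrArg Subtype.val hxa)⟩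
    simp [surface, hempty]

theorem surface_facet_ne_zero (hK : IsSimplex K) (hd : 0 < d) (a : K) :
    surface (facet K a) Set.univ ≠ 0 := by
  obtain ⟨b, hb⟩ := hK.exists_ne hd a
  rw [hK.surface_facet_univ hb.symm]
  exact mul_ne_zero (enorm_ne_zero.2 (hK.grad_ne_zero hd a)) (hK.volume_prism_ne_zero hb.symm)

theorem map_prod_surface (hK : IsSimplex K) {a b : K} (hab : a ≠ b) :
    ((surface (facet K a)).prod volume).map (fun p : Space d × ℝ => p.1 + p.2 • ((a : Space d) - b))
      = ‖hK.grad a‖ₑ • volume.restrict (hK.edgeTube a b) := by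
  have := hK.isFiniteMeasure_surface a
  have hfin : SFinite (μHE[d - 1].restrict (convexHull ℝ (facet K a : Set (Space d)))) :=
    inferInstanceAs (SFinite (surface (facet K a)))
  rw [surface, map_prod_add_smul (hK.linear_coord_self hab) (measurableSet_convexHull_finset _)
    fun _ hz => hK.coord_eq_zero_of_mem_facet hz]
  congr 2
  ext x
  exact hK.edgeProj_mem_facet_iff hab

theorem volume_edge_slab (hK : IsSimplex K) {a b : K} (hab : a ≠ b) {κ : Space d →ᵃ[ℝ] ℝ}
    (hκ : |κ.linear ((a : Space d) - b)| = 1) {A : Set (Space d)} (hA : MeasurableSet A) :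
    volume {x | κ x ∈ Set.Icc 0 1 ∧
        hK.edgeProj a b x ∈ A ∩ convexHull ℝ (facet K a : Set (Space d))}
      = ‖hK.grad a‖ₑ⁻¹ * surface (facet K a) A := by
  have := hK.isFiniteMeasure_surface a
  have : SFinite (μHE[d - 1].restrict (A ∩ convexHull ℝ (facet K a : Set (Space d)))) := by
    rw [← Measure.restrict_restrict hA]
    exact inferInstanceAs (SFinite ((surface (facet K a)).restrict A))
  rw [surface, Measure.restrict_apply hA]
  exact volume_slab (hK.linear_coord_self hab) (hA.inter (measurableSet_convexHull_finset _))
    (fun _ hz => hK.coord_eq_zero_of_mem_facet hz.2) hκ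

/-- Both sides, divided by the two gradient norms, measure the same union of unit segments
parallel to `a - b`. -/
theorem map_edgeProj_surface (hK : IsSimplex K) {a b : K} (hab : a ≠ b) :
    ‖hK.grad a‖ₑ • (surface (facet K b)).map (hK.edgeProj a b)
      = ‖hK.grad b‖ₑ • surface (facet K a) := by
  have hgrad {a b : K} (hab : a ≠ b) : ‖hK.grad a‖ₑ ≠ 0 :=
    enorm_ne_zero.2 (affGrad_ne_zero_of_linear_eq_one (hK.linear_coord_self hab))
  have hκ : |(hK.basis.coord b).linear ((b : Space d) - a)| = 1 := by
    rw [hK.linear_coord_self hab.symm, abs_one]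
  have hκ' : |(hK.basis.coord b).linear ((a : Space d) - b)| = 1 := by
    rwa [← neg_sub, map_neg, abs_neg]
  ext A hA
  have hpre := hA.preimage (hK.measurable_edgeProj a b)
  have hset : {x | hK.basis.coord b x ∈ Set.Icc 0 1 ∧ hK.edgeProj b a x
        ∈ hK.edgeProj a b ⁻¹' A ∩ convexHull ℝ (facet K b : Set (Space d))}
      = {x | hK.basis.coord b x ∈ Set.Icc 0 1 ∧
        hK.edgeProj a b x ∈ A ∩ convexHull ℝ (facet K a : Set (Space d))} := by
    ext x
    simp only [Set.mem_ofPred_eq, Set.mem_inter_iff, Set.mem_preimage,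
      hK.edgeProj_mem_facet_iff hab, hK.edgeProj_mem_facet_iff hab.symm, hK.edgeTube_comm b a,
      hK.edgeProj_edgeProj_swap hab]
  have hvol : ‖hK.grad b‖ₑ⁻¹ * surface (facet K b) (hK.edgeProj a b ⁻¹' A)
      = ‖hK.grad a‖ₑ⁻¹ * surface (facet K a) A := by
    rw [← hK.volume_edge_slab hab.symm hκ hpre, ← hK.volume_edge_slab hab hκ' hA, hset]
  rw [Measure.smul_apply, Measure.smul_apply, Measure.map_apply (hK.measurable_edgeProj a b) hA,
    smul_eq_mul, smul_eq_mul,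
    ← ENNReal.mul_inv_cancel_left (hgrad hab.symm) enorm_ne_top
      (b := surface (facet K b) (hK.edgeProj a b ⁻¹' A)),
    hvol, mul_left_comm, ENNReal.mul_inv_cancel_left (hgrad hab) enorm_ne_top]

theorem integrable_surface_facet (hK : IsSimplex K) (a : K) {g : Space d → ℝ}
    (hg : Continuous g) : Integrable g (surface (facet K a)) := by
  have := hK.isFiniteMeasure_surface a
  have hint := hg.continuousOn.integrableOn_compact (μ := surface (facet K a))
    (isCompact_convexHull_finset (facet K a))
  rwa [IntegrableOn, surface, Measure.restrict_restrict (measurableSet_convexHull_finset _),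
    Set.inter_self] at hint

theorem integral_edgeProj (hK : IsSimplex K) {a b : K} (hab : a ≠ b) {g : Space d → ℝ}
    (hg : Continuous g) :
    ‖hK.grad a‖ * ∫ x, g (hK.edgeProj a b x) ∂(surface (facet K b))
      = ‖hK.grad b‖ * ∫ x, g x ∂(surface (facet K a)) := by
  have h := congrArg (fun μ => ∫ x, g x ∂μ) (hK.map_edgeProj_surface hab)
  simpa only [integral_smul_measure, toReal_enorm, smul_eq_mul,
    integral_map (hK.measurable_edgeProj a b).aemeasurable hg.aestronglyMeasurable] using h

theorem add_smul_sub_mem_convexHull_iff (hK : IsSimplex K) {a b : K} (hab : a ≠ b) {z : Space d}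
    (hz : z ∈ convexHull ℝ (facet K a : Set (Space d))) {t : ℝ} :
    z + t • ((a : Space d) - b) ∈ convexHull ℝ (K : Set (Space d))
      ↔ t ∈ Set.Icc 0 (hK.basis.coord b z) := by
  obtain ⟨hza, hz⟩ := hK.mem_convexHull_facet_iff.1 hz
  rw [hK.mem_convexHull_iff, Set.mem_Icc]
  refine ⟨fun h => ⟨?_, ?_⟩, fun ⟨h0, h1⟩ c => ?_⟩
  · simpa only [hK.coord_add_smul_sub_left hab, hza, zero_add] using h a
  · simpa only [hK.coord_add_smul_sub_right hab, sub_nonneg] using h b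
  obtain rfl | hca := eq_or_ne c a
  · rwa [hK.coord_add_smul_sub_left hab, hza, zero_add]
  obtain rfl | hcb := eq_or_ne c b
  · rwa [hK.coord_add_smul_sub_right hab, sub_nonneg]
  · rw [hK.coord_add_smul_sub_of_ne hca hcb]
    exact hz c

theorem integral_convexHull_eq_integral_edge (hK : IsSimplex K) {a b : K} (hab : a ≠ b)
    {g : Space d → ℝ} (hg : Continuous g) :
    ‖hK.grad a‖ * ∫ x in convexHull ℝ (K : Set (Space d)), g x
      = ∫ z, (∫ t in 0..hK.basis.coord b z, g (z + t • ((a : Space d) - b)))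
          ∂(surface (facet K a)) := by
  have := hK.isFiniteMeasure_surface a
  set S := convexHull ℝ (K : Set (Space d))
  have hSm : MeasurableSet S := measurableSet_convexHull_finset K
  have hST : S ⊆ hK.edgeTube a b := fun x hx => (hK.mem_convexHull_iff_mem_edgeTube.1 hx).1
  have hadd : Measurable fun p : Space d × ℝ => p.1 + p.2 • ((a : Space d) - b) :=
    (continuous_fst.add (continuous_snd.smul continuous_const)).measurable
  have hint : Integrable (S.indicator g)
      (‖hK.grad a‖ₑ • volume.restrict (hK.edgeTube a b)) :=
    (((hg.continuousOn.integrableOn_compact (isCompact_convexHull_finset K)).integrable_indicator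
      hSm).restrict).smul_measure enorm_ne_top
  have hinner : ∀ᵐ z ∂(surface (facet K a)),
      ∫ t : ℝ, S.indicator g (z + t • ((a : Space d) - b))
        = ∫ t in 0..hK.basis.coord b z, g (z + t • ((a : Space d) - b)) := by
    filter_upwards [ae_surface_mem (facet K a)] with z hz
    rw [intervalIntegral.integral_of_le ((hK.mem_convexHull_facet_iff.1 hz).2 b),
      ← integral_Icc_eq_integral_Ioc, ← integral_indicator measurableSet_Icc]
    congr with t
    exact Set.indicator_eq_indicator (hK.add_smul_sub_mem_convexHull_iff hab hz) rfl
  calc ‖hK.grad a‖ * ∫ x in S, g x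
      = ∫ x, S.indicator g x ∂(‖hK.grad a‖ₑ • volume.restrict (hK.edgeTube a b)) := by
        rw [integral_smul_measure, toReal_enorm, smul_eq_mul, setIntegral_indicator hSm,
          Set.inter_eq_right.2 hST]
    _ = ∫ p : Space d × ℝ, S.indicator g (p.1 + p.2 • ((a : Space d) - b))
          ∂((surface (facet K a)).prod volume) := by
        rw [← hK.map_prod_surface hab] at hint ⊢
        exact integral_map hadd.aemeasurable hint.aestronglyMeasurable
    _ = ∫ z, (∫ t : ℝ, S.indicator g (z + t • ((a : Space d) - b))) ∂(surface (facet K a)) := by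
        rw [← hK.map_prod_surface hab] at hint
        exact integral_prod _ (hint.comp_measurable hadd)
    _ = _ := integral_congr_ae hinner

theorem integral_fderiv_edge (hK : IsSimplex K) {a b : K} (hab : a ≠ b) {g : Space d → ℝ}
    (hg : ContDiff ℝ 1 g) :
    ∫ x in convexHull ℝ (K : Set (Space d)), fderiv ℝ g x ((a : Space d) - b)
      = ‖hK.grad b‖⁻¹ * ∫ x, g x ∂(surface (facet K b))
        - ‖hK.grad a‖⁻¹ * ∫ x, g x ∂(surface (facet K a)) := by
  have hga : ‖hK.grad a‖ ≠ 0 :=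
    norm_ne_zero_iff.2 (affGrad_ne_zero_of_linear_eq_one (hK.linear_coord_self hab))
  have hgb : ‖hK.grad b‖ ≠ 0 :=
    norm_ne_zero_iff.2 (affGrad_ne_zero_of_linear_eq_one (hK.linear_coord_self hab.symm))
  have hg' : Continuous fun x => fderiv ℝ g x ((a : Space d) - b) :=
    (hg.continuous_fderiv one_ne_zero).clm_apply continuous_const
  have hedge (z : Space d) : ∫ t in 0..hK.basis.coord b z,
      fderiv ℝ g (z + t • ((a : Space d) - b)) ((a : Space d) - b)
        = g (hK.edgeProj b a z) - g z := by
    have hline (t : ℝ) : HasDerivAt (fun t : ℝ => z + t • ((a : Space d) - b))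
        ((a : Space d) - b) t := by
      simpa only [one_smul, id_eq] using ((hasDerivAt_id t).smul_const _).const_add z
    rw [intervalIntegral.integral_eq_sub_of_hasDerivAt
      (fun t _ => (hg.differentiable one_ne_zero _).hasFDerivAt.comp_hasDerivAt t (hline t))
      ((hg'.comp (by fun_prop)).intervalIntegrable _ _), hK.edgeProj_swap a b]
    simp
  have hproj : Integrable (fun z => g (hK.edgeProj b a z)) (surface (facet K a)) :=
    hK.integrable_surface_facet a (hg.continuous.comp
      (continuous_id.sub ((hK.basis.coord b).continuous_of_finiteDimensional.smul
        continuous_const)))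
  apply mul_left_cancel₀ hga
  rw [hK.integral_convexHull_eq_integral_edge hab hg']
  simp only [hedge]
  rw [integral_sub hproj (hK.integrable_surface_facet a hg.continuous), mul_sub,
    mul_inv_cancel_left₀ hga, mul_left_comm, ← hK.integral_edgeProj hab.symm hg.continuous,
    inv_mul_cancel_left₀ hgb]

theorem integral_fderiv (hK : IsSimplex K) (hd : 0 < d) {g : Space d → ℝ} (hg : ContDiff ℝ 1 g)
    (w : Space d) :
    ∫ x in convexHull ℝ (K : Set (Space d)), fderiv ℝ g x w
      = ∑ a : K, ∫ x, g x * inner ℝ w (outerNormal K (facet K a)) ∂(surface (facet K a)) := by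
  obtain ⟨b⟩ := hK.nonempty
  have hedge (a : K) : ∫ x in convexHull ℝ (K : Set (Space d)), fderiv ℝ g x ((a : Space d) - b)
      = ‖hK.grad b‖⁻¹ * ∫ x, g x ∂(surface (facet K b))
        - ‖hK.grad a‖⁻¹ * ∫ x, g x ∂(surface (facet K a)) := by
    obtain rfl | hab := eq_or_ne a b
    · simp
    · exact hK.integral_fderiv_edge hab hg
  have hint (v : Space d) : IntegrableOn (fun x => fderiv ℝ g x v)
      (convexHull ℝ (K : Set (Space d))) :=
    ((hg.continuous_fderiv one_ne_zero).clm_apply continuous_const).continuousOn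
      |>.integrableOn_compact (isCompact_convexHull_finset K)
  calc ∫ x in convexHull ℝ (K : Set (Space d)), fderiv ℝ g x w
      = ∫ x in convexHull ℝ (K : Set (Space d)),
          ∑ a : K, inner ℝ (hK.grad a) w * fderiv ℝ g x ((a : Space d) - b) := by
        congr with x
        conv_lhs => rw [← hK.sum_inner_grad_smul_sub b w]
        simp only [map_sum, map_smul, smul_eq_mul]
    _ = ∑ a : K, inner ℝ (hK.grad a) w *
          (‖hK.grad b‖⁻¹ * ∫ x, g x ∂(surface (facet K b))
            - ‖hK.grad a‖⁻¹ * ∫ x, g x ∂(surface (facet K a))) := by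
        rw [integral_finsetSum _ fun a _ => (hint _).const_mul _]
        simp only [integral_const_mul, hedge]
    _ = -∑ a : K, inner ℝ (hK.grad a) w *
          (‖hK.grad a‖⁻¹ * ∫ x, g x ∂(surface (facet K a))) := by
        simp only [mul_sub, Finset.sum_sub_distrib]
        rw [← Finset.sum_mul, hK.sum_inner_grad, zero_mul, zero_sub]
    _ = _ := by
        simp only [integral_mul_const, hK.outerNormal_facet hd, inner_neg_right,
          real_inner_smul_right, ← Finset.sum_neg_distrib, real_inner_comm w]
        exact Finset.sum_congr rfl fun a _ => by ring

theorem integral_trace_fderiv (hK : IsSimplex K) (hd : 0 < d) {q : Space d → Space d}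
    (hq : ContDiff ℝ 1 q) :
    ∫ x in convexHull ℝ (K : Set (Space d)), LinearMap.trace ℝ _ (fderiv ℝ q x).toLinearMap
      = ∑ a : K, ∫ x, inner ℝ (q x) (outerNormal K (facet K a)) ∂(surface (facet K a)) := by
  set e := EuclideanSpace.basisFun (Fin d) ℝ
  have hcomp (i : Fin d) : ContDiff ℝ 1 fun x => inner ℝ (e i) (q x) := contDiff_const.inner ℝ hq
  have hderiv (i : Fin d) (x : Space d) :
      fderiv ℝ (fun x => inner ℝ (e i) (q x)) x (e i) = inner ℝ (e i) (fderiv ℝ q x (e i)) := by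
    rw [fderiv_inner_apply ℝ (differentiableAt_const _) (hq.differentiable one_ne_zero x)]
    simp
  have hint (i : Fin d) : IntegrableOn
      (fun x => fderiv ℝ (fun x => inner ℝ (e i) (q x)) x (e i))
      (convexHull ℝ (K : Set (Space d))) :=
    (((hcomp i).continuous_fderiv one_ne_zero).clm_apply continuous_const).continuousOn
      |>.integrableOn_compact (isCompact_convexHull_finset K)
  calc ∫ x in convexHull ℝ (K : Set (Space d)), LinearMap.trace ℝ _ (fderiv ℝ q x).toLinearMap
      = ∫ x in convexHull ℝ (K : Set (Space d)),
          ∑ i, fderiv ℝ (fun x => inner ℝ (e i) (q x)) x (e i) := by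
        simp only [LinearMap.trace_eq_sum_inner _ e, hderiv, ContinuousLinearMap.coe_coe]
    _ = ∑ i, ∑ a : K, ∫ x, inner ℝ (e i) (q x) * inner ℝ (e i) (outerNormal K (facet K a))
          ∂(surface (facet K a)) := by
        rw [integral_finsetSum _ fun i _ => hint i]
        exact Finset.sum_congr rfl fun i _ => hK.integral_fderiv hd (hcomp i) (e i)
    _ = _ := by
        rw [Finset.sum_comm]
        refine Finset.sum_congr rfl fun a _ => ?_
        rw [← integral_finsetSum _ fun i _ =>
          (hK.integrable_surface_facet a (hcomp i).continuous).mul_const _]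
        simp only [real_inner_comm (q _), e.sum_inner_mul_inner]

theorem integral_inner_gradient_add (hK : IsSimplex K) (hd : 0 < d) (c : Space d × ℝ)
    {φ : Space d → ℝ} (hφ : ContDiff ℝ 1 φ) :
    ∫ x in convexHull ℝ (K : Set (Space d)),
        (inner ℝ (c.1 + c.2 • x) (gradient φ x) + d * c.2 * φ x)
      = ∑ a : K, ∫ x, φ x * inner ℝ (c.1 + c.2 • x) (outerNormal K (facet K a))
          ∂(surface (facet K a)) := by
  have hq : ContDiff ℝ 1 fun x => φ x • (c.1 + c.2 • x) :=
    hφ.smul (contDiff_const.add (contDiff_id.const_smul c.2))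
  have htrace (x : Space d) :
      LinearMap.trace ℝ _ (fderiv ℝ (fun x => φ x • (c.1 + c.2 • x)) x).toLinearMap
        = inner ℝ (c.1 + c.2 • x) (gradient φ x) + d * c.2 * φ x := by
    have hfield : HasFDerivAt (fun x : Space d => c.1 + c.2 • x)
        (c.2 • ContinuousLinearMap.id ℝ (Space d)) x :=
      ((hasFDerivAt_id x).const_smul c.2).const_add c.1
    have hderiv : HasFDerivAt (fun x => φ x • (c.1 + c.2 • x)) _ x :=
      (hφ.differentiable one_ne_zero x).hasFDerivAt.smul hfield
    have hgrad : inner ℝ (c.1 + c.2 • x) (gradient φ x) = fderiv ℝ φ x (c.1 + c.2 • x) := by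
      rw [real_inner_comm, gradient, InnerProductSpace.toDual_symm_apply]
    rw [hderiv.fderiv, hgrad]
    simp only [ContinuousLinearMap.toLinearMap_add, ContinuousLinearMap.toLinearMap_smul,
      ContinuousLinearMap.coe_id, ContinuousLinearMap.coe_smulRight, map_add, map_smul,
      LinearMap.trace_id, finrank_euclideanSpace, Fintype.card_fin, smul_eq_mul,
      LinearMap.trace_smulRight, ContinuousLinearMap.coe_coe]
    ring
  simpa only [htrace, real_inner_smul_left] using hK.integral_trace_fderiv hd hq

theorem coord_centroid_facet_pos (hK : IsSimplex K) {a b : K} (h : b ≠ a) :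
    0 < hK.basis.coord b ((facet K a).centroid ℝ id) := by
  classical
  have hmap : (Finset.univ.erase a).map (Function.Embedding.subtype (· ∈ K)) = facet K a := by
    ext x
    simp only [Finset.mem_map, Finset.mem_erase, Finset.mem_univ, and_true,
      Function.Embedding.subtype_apply, Subtype.exists, mem_facet, ne_eq,
      Subtype.ext_iff, exists_and_left, exists_prop, exists_eq_right_right]
  have hb : b ∈ Finset.univ.erase a := Finset.mem_erase.2 ⟨h, Finset.mem_univ b⟩
  have hcoord := hK.basis.coord_apply_centroid hb
  rw [← hmap, Finset.centroid_map]
  exact hcoord ▸ inv_pos.2 (by exact_mod_cast Finset.card_pos.2 ⟨b, hb⟩)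

theorem eventually_add_smul_mem_cell (hK : IsSimplex K) {a : K} {x w : Space d}
    (hxa : hK.basis.coord a x = 0) (hx : ∀ b, b ≠ a → 0 < hK.basis.coord b x)
    (hw : 0 < inner ℝ (hK.grad a) w) : ∀ᶠ ε in 𝓝[>] (0 : ℝ), x + ε • w ∈ cell K := by
  simp only [hK.mem_cell_iff, eventually_all]
  intro b
  by_cases hb : b = a
  · subst hb
    filter_upwards [self_mem_nhdsWithin] with ε hε
    have hcoord : hK.basis.coord b (x + ε • w) = ε * inner ℝ (hK.grad b) w := by
      rw [← sub_zero (hK.basis.coord b _), ← hxa, ← hK.inner_grad_sub, add_sub_cancel_left,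
        real_inner_smul_right]
    exact hcoord ▸ mul_pos hε hw
  · have hcont : Continuous fun ε : ℝ => hK.basis.coord b (x + ε • w) :=
      (continuous_barycentric_coord hK.basis b).comp (by fun_prop)
    refine (hcont.tendsto' 0 (hK.basis.coord b x) (by simp)).eventually (lt_mem_nhds (hx b hb))
      |>.filter_mono nhdsWithin_le_nhds

theorem orthogonal_vectorSpan_facet (hK : IsSimplex K) (hd : 0 < d) (a : K) :
    (vectorSpan ℝ (facet K a : Set (Space d)))ᗮ = ℝ ∙ outerNormal K (facet K a) := by
  rw [hK.vectorSpan_facet hd, Submodule.orthogonal_orthogonal, hK.outerNormal_facet hd,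
    ← neg_smul, Submodule.span_singleton_smul_eq]
  exact (neg_ne_zero.2 (inv_ne_zero (hK.norm_grad_ne_zero hd a))).isUnit

/-- The lowest-order Raviart-Thomas field `x ↦ c.1 + c.2 • x`, encoded by `c`, whose normal
component on the facet opposite to `a` is `F a`. -/
def rtCoef (hK : IsSimplex K) : (K → ℝ) →ₗ[ℝ] Space d × ℝ :=
  ∑ a, (LinearMap.proj a).smulRight (-(‖hK.grad a‖ • (a : Space d)), ‖hK.grad a‖)

theorem rtCoef_field (hK : IsSimplex K) (F : K → ℝ) (x : Space d) :
    (hK.rtCoef F).1 + (hK.rtCoef F).2 • x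
      = ∑ b : K, (F b * ‖hK.grad b‖) • (x - (b : Space d)) := by
  simp only [rtCoef, LinearMap.sum_apply, LinearMap.smulRight_apply, LinearMap.proj_apply,
    Prod.fst_sum, Prod.snd_sum, Prod.smul_mk, Finset.sum_smul, ← Finset.sum_add_distrib]
  exact Finset.sum_congr rfl fun b _ => by module

theorem inner_rtCoef (hK : IsSimplex K) (hd : 0 < d) (F : K → ℝ) (a : K) {x : Space d}
    (hx : x ∈ convexHull ℝ (facet K a : Set (Space d))) :
    inner ℝ ((hK.rtCoef F).1 + (hK.rtCoef F).2 • x) (outerNormal K (facet K a)) = F a := by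
  have hg := hK.norm_grad_ne_zero hd a
  rw [hK.rtCoef_field, sum_inner, Finset.sum_eq_single_of_mem a (Finset.mem_univ a)]
  · rw [real_inner_smul_left, hK.inner_sub_outerNormal hd, hK.coord_eq_zero_of_mem_facet hx,
      hK.coord_self]
    field_simp
    ring
  · intro b _ hb
    rw [real_inner_smul_left, hK.inner_sub_outerNormal hd, hK.coord_eq_zero_of_mem_facet hx,
      hK.coord_of_ne hb.symm, sub_zero, mul_zero, neg_zero, mul_zero]

theorem rtCoef_surjective (hK : IsSimplex K) (hd : 0 < d) :
    Function.Surjective hK.rtCoef := by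
  have hrank : Module.finrank ℝ (K → ℝ) = Module.finrank ℝ (Space d × ℝ) := by
    simp [hK.card_eq]
  refine (LinearMap.injective_iff_surjective_of_finrank_eq_finrank hrank).1
    ((injective_iff_map_eq_zero _).2 fun F hF => ?_)
  ext a
  simpa [hF] using (hK.inner_rtCoef hd F a (hK.centroid_facet_mem hd a)).symm

theorem rtCoef_eq_of_inner (hK : IsSimplex K) (hd : 0 < d) {F : K → ℝ} {c : Space d × ℝ}
    (h : ∀ a : K, ∀ x ∈ convexHull ℝ (facet K a : Set (Space d)),
      inner ℝ (c.1 + c.2 • x) (outerNormal K (facet K a)) = F a) : hK.rtCoef F = c := by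
  obtain ⟨G, rfl⟩ := hK.rtCoef_surjective hd c
  congr 1
  ext a
  have hmem := hK.centroid_facet_mem hd a
  rw [← h a _ hmem, hK.inner_rtCoef hd G a hmem]

end IsSimplex

namespace Mesh

variable {d : ℕ} {Ω : Set (Space d)} {T : Mesh Ω}

section Elements

variable (T) in
theorem isSimplex (K : T.cells) : IsSimplex K.1 :=
  ⟨T.card_cell K.1 K.2, T.affineIndependent K.1 K.2⟩

theorem coord_eq_zero_of_notMem {K L : T.cells} {a : K.1} (ha : (a : Space d) ∉ L.1) {x : Space d}
    (hxK : x ∈ convexHull ℝ (K.1 : Set (Space d)))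
    (hxL : x ∈ convexHull ℝ (L.1 : Set (Space d))) : (T.isSimplex K).basis.coord a x = 0 := by
  have hx := T.conforming K.1 K.2 L.1 L.2 ▸ Set.mem_inter hxK hxL
  have hsub : (K.1 : Set (Space d)) ∩ L.1 ⊆ facet K.1 a := fun y hy =>
    mem_facet.2 ⟨fun h => ha (h ▸ hy.2), hy.1⟩
  exact (T.isSimplex K).coord_eq_zero_of_mem_facet (convexHull_mono hsub hx)

theorem disjoint_cell {K L : T.cells} (h : K ≠ L) : Disjoint (cell K.1) (cell L.1) := by
  obtain ⟨a, haK, haL⟩ : ∃ a ∈ K.1, a ∉ L.1 := by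
    by_contra! hsub
    exact h (Subtype.ext (Finset.eq_of_subset_of_card_le hsub
      (by rw [T.card_cell _ K.2, T.card_cell _ L.2])))
  refine Set.disjoint_left.2 fun x hxK hxL => ?_
  exact ((T.isSimplex K).mem_cell_iff.1 hxK ⟨a, haK⟩).ne'
    (coord_eq_zero_of_notMem haL (interior_subset hxK) (interior_subset hxL))

variable (T) in
theorem exists_mem_convexHull {x : Space d} (hx : x ∈ Ω) :
    ∃ K : T.cells, x ∈ convexHull ℝ (K.1 : Set (Space d)) := by
  have hx' := subset_closure hx
  rw [← T.iUnion_closure, Set.mem_iUnion₂] at hx'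
  obtain ⟨K, hK, hxK⟩ := hx'
  exact ⟨⟨K, hK⟩, hxK⟩

variable (T) in
theorem iUnion_cell_ae_eq : (⋃ K : T.cells, cell K.1) =ᵐ[volume] Ω := by
  have hcells : (⋃ K : T.cells, cell K.1) ⊆ Ω := Set.iUnion_subset fun K => T.cell_subset _ K.2
  have hcover : Ω ⊆ ⋃ K : T.cells, convexHull ℝ (K.1 : Set (Space d)) := fun x hx =>
    Set.mem_iUnion.2 (T.exists_mem_convexHull hx)
  have hnull : (⋃ K : T.cells, cell K.1)
      =ᵐ[volume] ⋃ K : T.cells, convexHull ℝ (K.1 : Set (Space d)) :=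
    Filter.EventuallyEq.countable_iUnion fun K => cell_ae_eq K.1
  exact EventuallyLE.antisymm hcells.eventuallyLE (hcover.eventuallyLE.trans hnull.symm.le)

theorem ae_restrict_iff {p : Space d → Prop} :
    (∀ᵐ x ∂(volume.restrict Ω), p x) ↔
      ∀ K : T.cells, ∀ᵐ x ∂(volume.restrict (cell K.1)), p x := by
  rw [← Measure.restrict_congr_set T.iUnion_cell_ae_eq, ae_restrict_iUnion_iff]

theorem ae_restrict_cell {p : Space d → Prop} (h : ∀ᵐ x ∂(volume.restrict Ω), p x)
    (K : T.cells) : ∀ᵐ x ∂(volume.restrict (cell K.1)), p x :=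
  ae_restrict_iff.1 h K

variable (T) in
theorem setIntegral_eq_sum {g : Space d → ℝ} (hg : IntegrableOn g Ω) :
    ∫ x in Ω, g x = ∑ K : T.cells, ∫ x in cell K.1, g x := by
  rw [← Measure.restrict_congr_set T.iUnion_cell_ae_eq]
  exact integral_iUnion_fintype (fun K => isOpen_interior.measurableSet)
    (fun K L h => disjoint_cell h) fun K => hg.mono_set (T.cell_subset _ K.2)

end Elements

section Faces

theorem mem_adjacent {Γ : T.faces} {K : T.cells} : K ∈ T.adjacent Γ ↔ Γ.1 ⊆ K.1 := by
  rw [adjacent, Finset.mem_filter, and_iff_right (Finset.mem_univ K)]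

variable (T) in
/-- The face of the element `K` opposite to its vertex `a`. -/
def faceOf (K : T.cells) (a : K.1) : T.faces :=
  ⟨facet K.1 a, Finset.mem_biUnion.2 ⟨K.1, K.2, Finset.mem_powersetCard.2
    ⟨fun _ hx => (mem_facet.1 hx).2, by
      rw [facet, Finset.card_erase_of_mem a.2, T.card_cell _ K.2, Nat.add_sub_cancel]⟩⟩⟩

theorem mem_adjacent_faceOf (K : T.cells) (a : K.1) : K ∈ T.adjacent (T.faceOf K a) :=
  mem_adjacent.2 fun _ hx => (mem_facet.1 hx).2

theorem faceOf_injective (K : T.cells) : Function.Injective (T.faceOf K) := by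
  intro a b h
  by_contra hab
  have hmem : (b : Space d) ∈ facet K.1 a := vertex_mem_facet (Ne.symm hab)
  rw [show facet K.1 a = facet K.1 b from congrArg Subtype.val h] at hmem
  exact (mem_facet.1 hmem).1 rfl

theorem exists_eq_faceOf {Γ : T.faces} {K : T.cells} (h : K ∈ T.adjacent Γ) :
    ∃ a : K.1, Γ = T.faceOf K a := by
  classical
  obtain ⟨L, -, hL⟩ := Finset.mem_biUnion.1 Γ.2
  have hcard : (K.1 \ Γ.1).card = 1 := by
    rw [Finset.card_sdiff_of_subset (mem_adjacent.1 h), (Finset.mem_powersetCard.1 hL).2,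
      T.card_cell _ K.2, Nat.add_sub_cancel_left]
  obtain ⟨a, ha⟩ := Finset.card_eq_one.1 hcard
  have haK : a ∈ K.1 := (Finset.mem_sdiff.1 (ha ▸ Finset.mem_singleton_self a)).1
  refine ⟨⟨a, haK⟩, Subtype.ext ?_⟩
  rw [← Finset.sdiff_sdiff_eq_self (mem_adjacent.1 h), ha]
  ext x
  simp [faceOf, mem_facet, and_comm]

theorem exists_faceOf_eq (Γ : T.faces) : ∃ K a, T.faceOf K a = Γ := by
  obtain ⟨K, hK, hΓ⟩ := Finset.mem_biUnion.1 Γ.2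
  obtain ⟨a, ha⟩ := exists_eq_faceOf (K := ⟨K, hK⟩)
    (mem_adjacent.2 (Finset.mem_powersetCard.1 hΓ).1)
  exact ⟨⟨K, hK⟩, a, ha.symm⟩

theorem sum_faceOf {M : Type*} [AddCommMonoid M] (K : T.cells) {G : T.faces → M}
    (hG : ∀ Γ, K ∉ T.adjacent Γ → G Γ = 0) : ∑ a : K.1, G (T.faceOf K a) = ∑ Γ, G Γ := by
  refine Fintype.sum_of_injective _ (faceOf_injective K) _ _ (fun Γ hΓ => hG Γ fun hK => hΓ ?_)
    fun _ => rfl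
  obtain ⟨a, rfl⟩ := exists_eq_faceOf hK
  exact Set.mem_range_self a

theorem norm_outerNormal (hd : 0 < d) {Γ : T.faces} {K : T.cells} (hK : K ∈ T.adjacent Γ) :
    ‖outerNormal K.1 Γ.1‖ = 1 := by
  obtain ⟨a, rfl⟩ := exists_eq_faceOf hK
  exact (T.isSimplex K).norm_outerNormal hd a

theorem outerNormal_eq_or_eq_neg (hd : 0 < d) {Γ : T.faces} {K L : T.cells}
    (hK : K ∈ T.adjacent Γ) (hL : L ∈ T.adjacent Γ) :
    outerNormal L.1 Γ.1 = outerNormal K.1 Γ.1 ∨ outerNormal L.1 Γ.1 = -outerNormal K.1 Γ.1 := by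
  have hspan : ∀ J ∈ T.adjacent Γ,
      (vectorSpan ℝ (Γ.1 : Set (Space d)))ᗮ = ℝ ∙ outerNormal J.1 Γ.1 := by
    rintro J hJ
    obtain ⟨a, rfl⟩ := exists_eq_faceOf hJ
    exact (T.isSimplex J).orthogonal_vectorSpan_facet hd a
  obtain ⟨t, ht⟩ := Submodule.mem_span_singleton.1
    (hspan K hK ▸ hspan L hL ▸ Submodule.mem_span_singleton_self (outerNormal L.1 Γ.1))
  have habs : |t| = 1 := by
    simpa [norm_smul, norm_outerNormal hd hK, norm_outerNormal hd hL] using congrArg norm ht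
  rcases eq_or_eq_neg_of_abs_eq habs with rfl | rfl
  · exact Or.inl (by rw [← ht, one_smul])
  · exact Or.inr (by rw [← ht, neg_one_smul])

theorem eventually_sub_smul_outerNormal_mem_cell (hd : 0 < d) {Γ : T.faces} {K : T.cells}
    (hK : K ∈ T.adjacent Γ) :
    ∀ᶠ ε in 𝓝[>] (0 : ℝ), Γ.1.centroid ℝ id + ε • -outerNormal K.1 Γ.1 ∈ cell K.1 := by
  obtain ⟨a, rfl⟩ := exists_eq_faceOf hK
  have hS := T.isSimplex K
  refine hS.eventually_add_smul_mem_cell (a := a)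
    (hS.coord_eq_zero_of_mem_facet (hS.centroid_facet_mem hd a))
    (fun b hb => hS.coord_centroid_facet_pos hb) ?_
  have hg := norm_pos_iff.2 (hS.grad_ne_zero hd a)
  change 0 < inner ℝ (hS.grad a) (-outerNormal K.1 (facet K.1 a))
  rw [hS.outerNormal_facet hd, neg_neg, real_inner_smul_right, real_inner_self_eq_norm_sq]
  positivity

theorem outerNormal_eq_neg (hd : 0 < d) {Γ : T.faces} {K L : T.cells} (hK : K ∈ T.adjacent Γ)
    (hL : L ∈ T.adjacent Γ) (hKL : K ≠ L) : outerNormal L.1 Γ.1 = -outerNormal K.1 Γ.1 := by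
  refine (outerNormal_eq_or_eq_neg hd hK hL).resolve_left fun hsame => ?_
  have hmemL := eventually_sub_smul_outerNormal_mem_cell hd hL
  rw [hsame] at hmemL
  obtain ⟨ε, hεK, hεL⟩ := ((eventually_sub_smul_outerNormal_mem_cell hd hK).and hmemL).exists
  exact Set.disjoint_left.1 (disjoint_cell hKL) hεK hεL

theorem minus_mem_adjacent (o : T.Orientation) (Γ : T.faces) : o.minus Γ ∈ T.adjacent Γ :=
  mem_adjacent.2 (o.subset_minus Γ)

open scoped Classical in
theorem card_erase_minus_le_one (hd : 0 < d) (o : T.Orientation) (Γ : T.faces) :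
    ((T.adjacent Γ).erase (o.minus Γ)).card ≤ 1 := by
  refine Finset.card_le_one.2 fun K hK L hL => ?_
  by_contra hKL
  rw [Finset.mem_erase] at hK hL
  have hM := minus_mem_adjacent o Γ
  have hneg := outerNormal_eq_neg hd hK.2 hL.2 hKL
  rw [outerNormal_eq_neg hd hM hK.2 hK.1.symm, outerNormal_eq_neg hd hM hL.2 hL.1.symm,
    neg_neg] at hneg
  have hzero : outerNormal (o.minus Γ).1 Γ.1 = 0 := by
    linear_combination (norm := module) (-(1 / 2) : ℝ) • hneg
  simpa [hzero] using norm_outerNormal hd hM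

open scoped Classical in
/-- The incidence number of the element `K` with the face `Γ`: `1` for `K = K⁻`, `-1` for
`K = K⁺` and `0` if `Γ` is not a face of `K`. -/
def incidence (o : T.Orientation) (Γ : T.faces) (K : T.cells) : ℝ :=
  if K ∈ T.adjacent Γ then if K = o.minus Γ then 1 else -1 else 0

theorem incidence_of_notMem (o : T.Orientation) {Γ : T.faces} {K : T.cells}
    (h : K ∉ T.adjacent Γ) : incidence o Γ K = 0 :=
  if_neg h

theorem incidence_mul_self (o : T.Orientation) {Γ : T.faces} {K : T.cells}
    (hK : K ∈ T.adjacent Γ) : incidence o Γ K * incidence o Γ K = 1 := by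
  rw [incidence, if_pos hK]
  split_ifs <;> norm_num

theorem outerNormal_eq_incidence_smul (hd : 0 < d) (o : T.Orientation) {Γ : T.faces} {K : T.cells}
    (hK : K ∈ T.adjacent Γ) : outerNormal K.1 Γ.1 = incidence o Γ K • T.normal o Γ := by
  rw [incidence, if_pos hK, normal]
  split_ifs with h
  · rw [h, one_smul]
  · rw [neg_one_smul, outerNormal_eq_neg hd (minus_mem_adjacent o Γ) hK (Ne.symm h)]

theorem jump_eq_sum (o : T.Orientation) (Γ : T.faces) (w : T.cells → ℝ) :
    T.jump o Γ w = ∑ K, incidence o Γ K * w K := by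
  classical
  have hM := minus_mem_adjacent o Γ
  rw [jump, ← Finset.sum_subset (Finset.subset_univ (T.adjacent Γ)) fun K _ hK => by
    rw [incidence_of_notMem o hK, zero_mul], ← Finset.add_sum_erase _ _ hM, sub_eq_add_neg,
    ← Finset.sum_neg_distrib]
  congr 1
  · rw [incidence, if_pos hM, if_pos rfl, one_mul]
  · refine Finset.sum_congr rfl fun K hK => ?_
    obtain ⟨hne, hadj⟩ := Finset.mem_erase.1 hK
    rw [incidence, if_pos hadj, if_neg hne, neg_one_mul]

theorem notMem_of_coord_pos (hΩ : IsOpen Ω) {K : T.cells} {a : K.1}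
    (hK : T.adjacent (T.faceOf K a) = {K}) {x : Space d} (hxa : (T.isSimplex K).basis.coord a x = 0)
    (hx : ∀ b, b ≠ a → 0 < (T.isSimplex K).basis.coord b x) : x ∉ Ω := by
  intro hxΩ
  have hxK : x ∈ convexHull ℝ (K.1 : Set (Space d)) :=
    (T.isSimplex K).mem_convexHull_iff.2 fun b => by
      by_cases hb : b = a
      · exact hb ▸ hxa.ge
      · exact (hx b hb).le
  have hother : ∀ L, L ≠ K → x ∉ convexHull ℝ (L.1 : Set (Space d)) := fun L hne hxL => by
    refine hne (Finset.mem_singleton.1 (hK ▸ mem_adjacent.2 fun y hy => ?_))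
    by_contra hyL
    obtain ⟨hya, hyK⟩ := mem_facet.1 hy
    exact (hx ⟨y, hyK⟩ fun h => hya (congrArg Subtype.val h)).ne'
      (coord_eq_zero_of_notMem hyL hxK hxL)
  have hnear : ∀ᶠ y in 𝓝 x, y ∈ convexHull ℝ (K.1 : Set (Space d)) := by
    have hfar : ∀ᶠ y in 𝓝 x, ∀ L, L ≠ K → y ∉ convexHull ℝ (L.1 : Set (Space d)) :=
      eventually_all.2 fun L => eventually_imp_distrib_left.2 fun hne =>
        (isCompact_convexHull_finset L.1).isClosed.isOpen_compl.mem_nhds (hother L hne)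
    filter_upwards [hΩ.mem_nhds hxΩ, hfar] with y hyΩ hy
    obtain ⟨L, hyL⟩ := T.exists_mem_convexHull hyΩ
    by_contra hyK
    exact hy L (fun h => hyK (h ▸ hyL)) hyL
  exact ((T.isSimplex K).mem_cell_iff.1 (mem_interior_iff_mem_nhds.2 hnear) a).ne' hxa

theorem notMem_of_adjacent_eq_singleton (hd : 0 < d) (hΩ : IsOpen Ω) {Γ : T.faces} {K : T.cells}
    (hK : T.adjacent Γ = {K}) {x : Space d} (hx : x ∈ convexHull ℝ (Γ.1 : Set (Space d))) :
    x ∉ Ω := by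
  obtain ⟨a, rfl⟩ := exists_eq_faceOf (hK ▸ Finset.mem_singleton_self K)
  have hS := T.isSimplex K
  set z := (facet K.1 a).centroid ℝ id
  obtain ⟨hxa, hxnn⟩ := hS.mem_convexHull_facet_iff.1 hx
  have hza : hS.basis.coord a z = 0 := hS.coord_eq_zero_of_mem_facet (hS.centroid_facet_mem hd a)
  have hseg : openSegment ℝ x z ⊆ Ωᶜ := by
    rw [openSegment_eq_image_lineMap]
    rintro _ ⟨t, ⟨ht0, ht1⟩, rfl⟩
    refine notMem_of_coord_pos hΩ hK ?_ fun b hb => ?_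
    · rw [AffineMap.apply_lineMap, hxa, hza, AffineMap.lineMap_same_apply]
    · rw [AffineMap.apply_lineMap, AffineMap.lineMap_apply_ring]
      have hzb : 0 < hS.basis.coord b z := hS.coord_centroid_facet_pos hb
      have hxb := hxnn b
      have := sub_pos.2 ht1
      positivity
  have hclosure := closure_minimal hseg hΩ.isClosed_compl
  rw [closure_openSegment] at hclosure
  exact hclosure (left_mem_segment ℝ x z)

end Faces

end Mesh

theorem isFiniteMeasure_restrict_cell {d : ℕ} (K : Finset (Space d)) :
    IsFiniteMeasure (volume.restrict (cell K)) :=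
  isFiniteMeasure_restrict.2
    ((measure_mono interior_subset).trans_lt (isCompact_convexHull_finset K).measure_lt_top).ne

theorem memLp_cell {d : ℕ} {E : Type*} [NormedAddCommGroup E] (K : Finset (Space d))
    {g : Space d → E} (hg : Continuous g) (p : ENNReal) : MemLp g p (volume.restrict (cell K)) := by
  have := isFiniteMeasure_restrict_cell K
  obtain ⟨C, hC⟩ := (isCompact_convexHull_finset K).exists_bound_of_continuousOn hg.continuousOn
  refine MemLp.of_bound hg.aestronglyMeasurable C ?_
  filter_upwards [ae_restrict_mem isOpen_interior.measurableSet] with x hx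
  exact hC x (interior_subset hx)

theorem HDiv.ext_field {d : ℕ} {Ω : Set (Space d)} (hΩ : IsOpen Ω) {q r : HDiv Ω}
    (h : field q = field r) : q = r := by
  refine Subtype.ext (WithLp.ofLp_injective 2 (Prod.ext h (sub_eq_zero.1 ?_)))
  change div q - div r = 0
  refine Lp.eq_zero_iff_ae_eq_zero.2 ((ae_restrict_iff' hΩ.measurableSet).2 ?_)
  refine hΩ.ae_eq_zero_of_integral_contDiff_smul_eq_zero
    (locallyIntegrableOn_of_locallyIntegrable_restrict
      ((Lp.memLp _).locallyIntegrable one_le_two)) fun φ hsmooth hsupp hsub => ?_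
  have hφ : IsTestFunction Ω φ := ⟨hsmooth, hsupp, hsub⟩
  have hqr : ∫ x in Ω, div q x * φ x = ∫ x in Ω, div r x * φ x := by
    refine neg_injective ((q.2 φ hφ).symm.trans (Eq.trans ?_ (r.2 φ hφ)))
    exact congrArg (fun w : L2Vec Ω => ∫ x in Ω, inner ℝ (w x) (gradient φ x)) h
  calc ∫ x, φ x • (div q - div r) x
      = ∫ x in Ω, φ x • (div q - div r) x :=
        (setIntegral_eq_integral_of_forall_compl_eq_zero fun x hx => by
          rw [image_eq_zero_of_notMem_tsupport fun hx' => hx (hsub hx'), zero_smul]).symm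
    _ = ∫ x in Ω, (div q x * φ x - div r x * φ x) := by
        refine integral_congr_ae ?_
        filter_upwards [Lp.coeFn_sub (div q) (div r)] with x hx
        rw [hx, Pi.sub_apply, smul_eq_mul, mul_comm, sub_mul]
    _ = 0 := by
        rw [integral_sub (hφ.integrable_mul _) (hφ.integrable_mul _), hqr, sub_self]

namespace Mesh

variable {d : ℕ} {Ω : Set (Space d)} {T : Mesh Ω}

section Piecewise

variable {E : Type*} [NormedAddCommGroup E]

/-- The function that equals `g K` on the element `K`, extended by `0`. -/
def piecewise (g : T.cells → Space d → E) (x : Space d) : E :=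
  ∑ K : T.cells, (cell K.1).indicator (g K) x

theorem piecewise_of_mem (g : T.cells → Space d → E) {K : T.cells} {x : Space d}
    (hx : x ∈ cell K.1) : piecewise g x = g K x := by
  rw [piecewise, Finset.sum_eq_single_of_mem K (Finset.mem_univ K), Set.indicator_of_mem hx]
  intro L _ hLK
  exact Set.indicator_of_notMem (fun h => Set.disjoint_left.1 (disjoint_cell hLK) h hx) _

theorem memLp_piecewise {g : T.cells → Space d → E} (hg : ∀ K, Continuous (g K)) (p : ENNReal) :
    MemLp (piecewise g) p (volume.restrict Ω) :=
  memLp_finsetSum _ fun K _ => MemLp.restrict Ω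
    ((memLp_indicator_iff_restrict isOpen_interior.measurableSet).2 (memLp_cell _ (hg K) p))

theorem coeFn_piecewise {g : T.cells → Space d → E} (hg : ∀ K, Continuous (g K)) (p : ENNReal)
    (K : T.cells) :
    ∀ᵐ x ∂(volume.restrict (cell K.1)), (memLp_piecewise hg p).toLp _ x = g K x := by
  filter_upwards [ae_restrict_cell (memLp_piecewise hg p).coeFn_toLp K,
    ae_restrict_mem isOpen_interior.measurableSet] with x hx hmem
  rw [hx, piecewise_of_mem g hmem]

end Piecewise

section RaviartThomas

variable (o : T.Orientation)

/-- On the element `K`, the lowest-order Raviart-Thomas field `x ↦ c.1 + c.2 • x`, encoded by `c`,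
with normal components `F`. -/
def rtCell (K : T.cells) : (T.faces → ℝ) →ₗ[ℝ] Space d × ℝ :=
  (T.isSimplex K).rtCoef ∘ₗ
    LinearMap.pi fun a => incidence o (T.faceOf K a) K • LinearMap.proj (T.faceOf K a)

theorem inner_rtCell_outerNormal (hd : 0 < d) (F : T.faces → ℝ) {Γ : T.faces} {K : T.cells}
    (hK : K ∈ T.adjacent Γ) {x : Space d} (hx : x ∈ convexHull ℝ (Γ.1 : Set (Space d))) :
    inner ℝ ((rtCell o K F).1 + (rtCell o K F).2 • x) (outerNormal K.1 Γ.1)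
      = incidence o Γ K * F Γ := by
  obtain ⟨a, rfl⟩ := exists_eq_faceOf hK
  exact (T.isSimplex K).inner_rtCoef hd _ a hx

theorem inner_rtCell (hd : 0 < d) (F : T.faces → ℝ) {Γ : T.faces} {K : T.cells}
    (hK : K ∈ T.adjacent Γ) {x : Space d} (hx : x ∈ convexHull ℝ (Γ.1 : Set (Space d))) :
    inner ℝ ((rtCell o K F).1 + (rtCell o K F).2 • x) (T.normal o Γ) = F Γ := by
  have h := inner_rtCell_outerNormal o hd F hK hx
  rw [outerNormal_eq_incidence_smul hd o hK, real_inner_smul_right] at h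
  exact mul_left_cancel₀ (left_ne_zero_of_mul_eq_one (incidence_mul_self o hK)) h

theorem rtCell_eq_of_inner (hd : 0 < d) {F : T.faces → ℝ} {K : T.cells} {c : Space d × ℝ}
    (h : ∀ Γ, K ∈ T.adjacent Γ → ∀ x ∈ convexHull ℝ (Γ.1 : Set (Space d)),
      inner ℝ (c.1 + c.2 • x) (T.normal o Γ) = F Γ) : rtCell o K F = c := by
  refine (T.isSimplex K).rtCoef_eq_of_inner hd fun a x hx => ?_
  have hK := mem_adjacent_faceOf K a
  change inner ℝ _ (outerNormal K.1 (T.faceOf K a).1) = _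
  rw [outerNormal_eq_incidence_smul hd o hK, real_inner_smul_right, h _ hK x hx]
  rfl

theorem integral_rtCell (hd : 0 < d) (F : T.faces → ℝ) (K : T.cells) {φ : Space d → ℝ}
    (hφ : ContDiff ℝ 1 φ) :
    ∫ x in cell K.1, (inner ℝ ((rtCell o K F).1 + (rtCell o K F).2 • x) (gradient φ x)
        + d * (rtCell o K F).2 * φ x)
      = ∑ Γ : T.faces, incidence o Γ K * (F Γ * ∫ x, φ x ∂(surface Γ.1)) := by
  rw [setIntegral_congr_set (cell_ae_eq K.1), (T.isSimplex K).integral_inner_gradient_add hd _ hφ,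
    ← sum_faceOf K fun Γ hΓ => by rw [incidence_of_notMem o hΓ, zero_mul]]
  refine Finset.sum_congr rfl fun a _ => ?_
  rw [← mul_assoc, ← integral_const_mul]
  refine integral_congr_ae ((ae_surface_mem _).mono fun x hx => ?_)
  exact (congrArg (φ x * ·) (inner_rtCell_outerNormal o hd F (mem_adjacent_faceOf K a) hx)).trans
    (mul_comm _ _)

theorem sum_incidence (Γ : T.faces) [DecidableEq T.cells] :
    ∑ K, incidence o Γ K = 1 - ((T.adjacent Γ).erase (o.minus Γ)).card := by
  have h := jump_eq_sum o Γ fun _ => 1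
  simp only [mul_one] at h
  rw [← h, jump, Finset.sum_const, nsmul_one]
  congr!

theorem sum_incidence_mul_integral (hd : 0 < d) (hΩ : IsOpen Ω) (Γ : T.faces) {φ : Space d → ℝ}
    (hφ : IsTestFunction Ω φ) : (∑ K, incidence o Γ K) * ∫ x, φ x ∂(surface Γ.1) = 0 := by
  classical
  rcases Nat.le_one_iff_eq_zero_or_eq_one.1 (card_erase_minus_le_one hd o Γ) with hcard | hcard
  · have hadj : T.adjacent Γ = {o.minus Γ} := by
      rw [← Finset.insert_erase (minus_mem_adjacent o Γ), Finset.card_eq_zero.1 hcard,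
        insert_empty_eq]
    rw [integral_eq_zero_of_ae ((ae_surface_mem Γ.1).mono fun x hx => ?_), mul_zero]
    exact image_eq_zero_of_notMem_tsupport fun h =>
      notMem_of_adjacent_eq_singleton hd hΩ hadj hx (hφ.2.2 h)
  · rw [sum_incidence, hcard, Nat.cast_one, sub_self, zero_mul]

/-- The Raviart-Thomas field on `Ω` with normal components `F`. -/
def rtField (F : T.faces → ℝ) : L2Vec Ω :=
  (memLp_piecewise (g := fun K x => (rtCell o K F).1 + (rtCell o K F).2 • x)
    (fun K => by fun_prop) 2).toLp _

/-- The divergence of `rtField o F`. -/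
def rtDiv (F : T.faces → ℝ) : L2Scal Ω :=
  (memLp_piecewise (g := fun K _ => d * (rtCell o K F).2) (fun _ => continuous_const) 2).toLp _

theorem coeFn_rtField (F : T.faces → ℝ) (K : T.cells) :
    ∀ᵐ x ∂(volume.restrict (cell K.1)), rtField o F x = (rtCell o K F).1 + (rtCell o K F).2 • x :=
  coeFn_piecewise (fun _ => by fun_prop) 2 K

theorem coeFn_rtDiv (F : T.faces → ℝ) (K : T.cells) :
    ∀ᵐ x ∂(volume.restrict (cell K.1)), rtDiv o F x = d * (rtCell o K F).2 :=
  coeFn_piecewise (fun _ => continuous_const) 2 K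

theorem isWeakDiv_rtField (hd : 0 < d) (hΩ : IsOpen Ω) (F : T.faces → ℝ) :
    IsWeakDiv Ω (rtField o F) (rtDiv o F) := by
  intro φ hφ
  have hcell : ∀ K : T.cells,
      ∫ x in cell K.1, (inner ℝ (rtField o F x) (gradient φ x) + rtDiv o F x * φ x)
        = ∑ Γ : T.faces, incidence o Γ K * (F Γ * ∫ x, φ x ∂(surface Γ.1)) := fun K => by
    rw [← integral_rtCell o hd F K (hφ.1.of_le (by simp))]
    refine integral_congr_ae ?_
    filter_upwards [coeFn_rtField o F K, coeFn_rtDiv o F K] with x hfield hdiv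
    rw [hfield, hdiv]
  have hsum := T.setIntegral_eq_sum
    ((hφ.integrable_inner (rtField o F)).add (hφ.integrable_mul (rtDiv o F)))
  simp only [Pi.add_apply, hcell] at hsum
  rw [← add_eq_zero_iff_eq_neg, ← integral_add (hφ.integrable_inner _) (hφ.integrable_mul _), hsum,
    Finset.sum_comm]
  refine Finset.sum_eq_zero fun Γ _ => ?_
  rw [← Finset.sum_mul, mul_left_comm, sum_incidence_mul_integral o hd hΩ Γ hφ, mul_zero]

theorem hdiv_ext (hΩ : IsOpen Ω) {q r : HDiv Ω}
    (h : ∀ K : T.cells, ∀ᵐ x ∂(volume.restrict (cell K.1)), HDiv.field q x = HDiv.field r x) :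
    q = r :=
  HDiv.ext_field hΩ (Lp.ext (ae_restrict_iff.2 h))

/-- The element of the Raviart-Thomas space with normal components `F`, as a linear function of
`F`. -/
def rtLift (hd : 0 < d) (hΩ : IsOpen Ω) : (T.faces → ℝ) →ₗ[ℝ] HDiv Ω where
  toFun F := ⟨WithLp.toLp 2 (rtField o F, rtDiv o F), isWeakDiv_rtField o hd hΩ F⟩
  map_add' F G := hdiv_ext hΩ fun K => by
    change ∀ᵐ x ∂_, rtField o (F + G) x = (rtField o F + rtField o G) x
    filter_upwards [coeFn_rtField o (F + G) K, coeFn_rtField o F K, coeFn_rtField o G K,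
      ae_restrict_cell (Lp.coeFn_add (rtField o F) (rtField o G)) K] with x hFG hF hG hadd
    rw [hFG, hadd, Pi.add_apply, hF, hG, map_add, Prod.fst_add, Prod.snd_add]
    module
  map_smul' t F := hdiv_ext hΩ fun K => by
    change ∀ᵐ x ∂_, rtField o (t • F) x = (t • rtField o F) x
    filter_upwards [coeFn_rtField o (t • F) K, coeFn_rtField o F K,
      ae_restrict_cell (Lp.coeFn_smul t (rtField o F)) K] with x htF hF hsmul
    rw [htF, hsmul, Pi.smul_apply, hF, map_smul, Prod.smul_fst, Prod.smul_snd]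
    module

theorem isRT0With_rtLift (hd : 0 < d) (hΩ : IsOpen Ω) (F : T.faces → ℝ) :
    T.IsRT0With o (rtLift o hd hΩ F) fun K => rtCell o K F where
  ae_eq := coeFn_rtField o F
  normal_continuous Γ K hK L hL x hx := by
    rw [inner_rtCell o hd F hK hx, inner_rtCell o hd F hL hx]

end RaviartThomas

section Reconstruction

theorem surface_real_ne_zero (hd : 0 < d) (Γ : T.faces) : (surface Γ.1).real Set.univ ≠ 0 := by
  obtain ⟨K, a, rfl⟩ := exists_faceOf_eq Γ
  have := (T.isSimplex K).isFiniteMeasure_surface a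
  exact ENNReal.toReal_ne_zero.2
    ⟨(T.isSimplex K).surface_facet_ne_zero hd a, measure_ne_top (surface (facet K.1 a)) _⟩

theorem integrable_surface (Γ : T.faces) {g : Space d → ℝ} (hg : Continuous g) :
    Integrable g (surface Γ.1) := by
  obtain ⟨K, a, rfl⟩ := exists_faceOf_eq Γ
  exact (T.isSimplex K).integrable_surface_facet a hg

theorem inner_normal_eq (hd : 0 < d) (o : T.Orientation) {Γ : T.faces} (c : Space d × ℝ)
    {x y : Space d} (hx : x ∈ convexHull ℝ (Γ.1 : Set (Space d)))
    (hy : y ∈ convexHull ℝ (Γ.1 : Set (Space d))) :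
    inner ℝ (c.1 + c.2 • x) (T.normal o Γ) = inner ℝ (c.1 + c.2 • y) (T.normal o Γ) := by
  obtain ⟨a, ha⟩ := exists_eq_faceOf (minus_mem_adjacent o Γ)
  have hS := T.isSimplex (o.minus Γ)
  have hxa := hS.coord_eq_zero_of_mem_facet (a := a) (congrArg Subtype.val ha ▸ hx)
  have hya := hS.coord_eq_zero_of_mem_facet (a := a) (congrArg Subtype.val ha ▸ hy)
  have horth : inner ℝ (x - y) (T.normal o Γ) = 0 := by
    rw [normal, show Γ.1 = facet (o.minus Γ).1 a from congrArg Subtype.val ha,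
      hS.inner_sub_outerNormal hd, hxa, hya, sub_zero, mul_zero, neg_zero]
  rw [← sub_eq_zero, ← inner_sub_left, add_sub_add_left_eq_sub, ← smul_sub, real_inner_smul_left,
    horth, mul_zero]

theorem integral_surface_of_forall_eq {Γ : Finset (Space d)} {g : Space d → ℝ} {r : ℝ}
    (h : ∀ x ∈ convexHull ℝ (Γ : Set (Space d)), g x = r) :
    ∫ x, g x ∂(surface Γ) = (surface Γ).real Set.univ * r := by
  rw [integral_congr_ae ((ae_surface_mem Γ).mono h), integral_const, smul_eq_mul]

variable (o : T.Orientation) (ν : ℝ) (s : Space d → ℝ) (v : T.DGSpace)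

/-- The flux `∫_Γ -⟨(s ∇v) · n⟩ + ν / h_Γ [v]` over the face `Γ` that the reconstruction of `v` is
required to have. -/
def faceFlux (Γ : T.faces) : ℝ :=
  ∫ x, (- T.avgFlux o s v Γ x + ν / faceDiam Γ.1 * T.jumpAt o v Γ x) ∂(surface Γ.1)

/-- The constant normal component on the face `Γ` whose flux over `Γ` is `faceFlux o ν s v Γ`. -/
def meanFlux (Γ : T.faces) : ℝ := faceFlux o ν s v Γ / (surface Γ.1).real Set.univ

theorem surface_mul_meanFlux (hd : 0 < d) (Γ : T.faces) :
    (surface Γ.1).real Set.univ * meanFlux o ν s v Γ = faceFlux o ν s v Γ :=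
  mul_div_cancel₀ _ (surface_real_ne_zero hd Γ)

theorem isFluxReconstruction_iff (hd : 0 < d) (hΩ : IsOpen Ω) (q : HDiv Ω) :
    T.IsFluxReconstruction o ν s v q ↔ q = rtLift o hd hΩ (meanFlux o ν s v) := by
  constructor
  · rintro ⟨c, ⟨hfield, hcont⟩, hflux⟩
    have hc : ∀ K, rtCell o K (meanFlux o ν s v) = c K := fun K =>
      rtCell_eq_of_inner o hd fun Γ hK x hx => by
        rw [hcont Γ K hK _ (minus_mem_adjacent o Γ) x hx]
        refine eq_div_of_mul_eq (surface_real_ne_zero hd Γ) ?_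
        rw [faceFlux, ← hflux Γ, mul_comm,
          integral_surface_of_forall_eq fun y hy => inner_normal_eq hd o _ hy hx]
    refine hdiv_ext (T := T) hΩ fun K => ?_
    filter_upwards [hfield K, (isRT0With_rtLift o hd hΩ _).ae_eq K] with x hx hF
    rw [hx, hF, hc]
  · rintro rfl
    refine ⟨_, isRT0With_rtLift o hd hΩ _, fun Γ => ?_⟩
    rw [integral_surface_of_forall_eq fun x hx =>
      inner_rtCell o hd (meanFlux o ν s v) (minus_mem_adjacent o Γ) hx,
      surface_mul_meanFlux o ν s v hd, faceFlux]

theorem existsUnique_isFluxReconstruction (hd : 0 < d) (hΩ : IsOpen Ω) :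
    ∃! q, T.IsFluxReconstruction o ν s v q := by
  simp only [isFluxReconstruction_iff o ν s v hd hΩ]
  exact existsUnique_eq

theorem fluxReconstruction_eq_rtLift (hd : 0 < d) (hΩ : IsOpen Ω) :
    T.fluxReconstruction o ν s v = rtLift o hd hΩ (meanFlux o ν s v) := by
  have h := (existsUnique_isFluxReconstruction o ν s v hd hΩ).exists
  rw [← isFluxReconstruction_iff, fluxReconstruction, dif_pos h]
  exact h.choose_spec

end Reconstruction

section Conservation

theorem integrableOn_cell (g : L2Scal Ω) (K : T.cells) : IntegrableOn g (cell K.1) := by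
  have := isFiniteMeasure_restrict_cell K.1
  exact ((Lp.memLp g).mono_measure (Measure.restrict_mono_set _ (T.cell_subset _ K.2))).integrable
    one_le_two

/-- The integral of the divergence over an element. -/
def divIntegral (K : T.cells) : HDiv Ω →ₗ[ℝ] ℝ where
  toFun q := ∫ x in cell K.1, HDiv.div q x
  map_add' p q := by
    rw [← integral_add (integrableOn_cell _ K) (integrableOn_cell _ K)]
    exact integral_congr_ae (ae_restrict_cell (Lp.coeFn_add (HDiv.div p) (HDiv.div q)) K)
  map_smul' r q := by
    rw [RingHom.id_apply, smul_eq_mul, ← integral_const_mul]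
    exact integral_congr_ae (ae_restrict_cell (Lp.coeFn_smul r (HDiv.div q)) K)

theorem mem_conservative {g : Space d → ℝ} {q : HDiv Ω} :
    q ∈ T.conservative g ↔ ∀ K : T.cells, divIntegral K q = ∫ x in cell K.1, g x := by
  simp only [conservative, Set.mem_ofPred_eq, Subtype.forall]
  rfl

theorem divIntegral_fluxReconstruction (hd : 0 < d) (hΩ : IsOpen Ω) (o : T.Orientation) (ν : ℝ)
    (s : Space d → ℝ) (v : T.DGSpace) (K : T.cells) :
    divIntegral K (T.fluxReconstruction o ν s v)
      = ∑ Γ : T.faces, incidence o Γ K * faceFlux o ν s v Γ := by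
  rw [fluxReconstruction_eq_rtLift o ν s v hd hΩ]
  have hdiv := integral_rtCell o hd (meanFlux o ν s v) K (φ := fun _ => 1) contDiff_const
  simp only [gradient_fun_const, inner_zero_right, zero_add, mul_one] at hdiv
  simp only [integral_const, smul_eq_mul, mul_one, mul_comm (meanFlux o ν s v _),
    surface_mul_meanFlux o ν s v hd] at hdiv
  rw [← hdiv, ← smul_eq_mul, ← integral_const]
  exact integral_congr_ae (coeFn_rtDiv o _ K)

open scoped Classical in
/-- The characteristic function of an element. -/
def charFun (K : T.cells) : T.DGSpace := Pi.single K (AffineMap.const ℝ (Space d) 1)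

theorem charFun_self_apply (K : T.cells) (x : Space d) : charFun K K x = 1 := by
  rw [charFun, Pi.single_eq_same, AffineMap.const_apply]

theorem charFun_of_ne {K L : T.cells} (h : L ≠ K) : charFun K L = 0 :=
  Pi.single_eq_of_ne h _

theorem charFun_apply_of_ne {K L : T.cells} (h : L ≠ K) (x : Space d) : charFun K L x = 0 := by
  rw [charFun_of_ne h, AffineMap.coe_zero, Pi.zero_apply]

theorem affGrad_charFun (K L : T.cells) : affGrad (charFun K L) = 0 := by
  by_cases h : L = K
  · subst h
    simp [affGrad, charFun]
  · simp [affGrad, charFun_of_ne h]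

theorem jumpAt_charFun (o : T.Orientation) (K : T.cells) (Γ : T.faces) (x : Space d) :
    T.jumpAt o (charFun K) Γ x = incidence o Γ K := by
  rw [jumpAt, jump_eq_sum, Finset.sum_eq_single_of_mem K (Finset.mem_univ K) fun L _ hL => by
    rw [charFun_apply_of_ne hL, mul_zero], charFun_self_apply, mul_one]

theorem avgFlux_charFun (o : T.Orientation) (s : Space d → ℝ) (K : T.cells) (Γ : T.faces)
    (x : Space d) : T.avgFlux o s (charFun K) Γ x = 0 := by
  simp only [avgFlux, avg, affGrad_charFun, inner_zero_left, mul_zero, Finset.sum_const_zero]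

theorem ipForm_charFun (o : T.Orientation) (ν : ℝ) (s : Space d → ℝ) (u : T.DGSpace)
    (K : T.cells) :
    T.ipForm o ν s u (charFun K) = ∑ Γ : T.faces, incidence o Γ K * faceFlux o ν s u Γ := by
  simp only [ipForm, affGrad_charFun, inner_zero_right, mul_zero, integral_zero,
    Finset.sum_const_zero, zero_add, avgFlux_charFun, neg_zero, zero_mul, zero_sub,
    jumpAt_charFun, faceFlux, ← integral_const_mul]
  refine Finset.sum_congr rfl fun Γ _ => integral_congr_ae (ae_of_all _ fun x => ?_)
  ring

theorem load_charFun (f : Space d → ℝ) (K : T.cells) :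
    T.load f (charFun K) = ∫ x in cell K.1, f x := by
  rw [load, Finset.sum_eq_single_of_mem K (Finset.mem_univ K) fun L _ hL => by
    simp only [charFun_apply_of_ne hL, mul_zero, integral_zero]]
  simp only [charFun_self_apply, mul_one]

/- Testing the discrete equation with the characteristic function of `K` turns it into the balance
of the face fluxes over `∂K`. -/
theorem IsGalerkinSolution.fluxReconstruction_mem_conservative (hd : 0 < d) (hΩ : IsOpen Ω)
    {o : T.Orientation} {ν : ℝ} {s f : Space d → ℝ} {u : T.DGSpace}
    (hu : T.IsGalerkinSolution o ν s f ⊤ u) : T.fluxReconstruction o ν s u ∈ T.conservative f :=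
  mem_conservative.2 fun K => by
    rw [divIntegral_fluxReconstruction hd hΩ, ← ipForm_charFun, hu.2 _ trivial, load_charFun]

theorem sub_mem_conservative_zero {f : Space d → ℝ} {p q : HDiv Ω} (hp : p ∈ T.conservative f)
    (hq : q ∈ T.conservative f) : p - q ∈ T.conservative fun _ => 0 :=
  mem_conservative.2 fun K => by
    rw [map_sub, mem_conservative.1 hp K, mem_conservative.1 hq K, sub_self, integral_zero]

theorem add_mem_conservative {f : Space d → ℝ} {p q : HDiv Ω}
    (hp : p ∈ T.conservative fun _ => 0) (hq : q ∈ T.conservative f) :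
    p + q ∈ T.conservative f :=
  mem_conservative.2 fun K => by
    rw [map_add, mem_conservative.1 hp K, mem_conservative.1 hq K, integral_zero, zero_add]

theorem span_subset_conservative_zero {S : Set (HDiv Ω)} (h : S ⊆ T.conservative fun _ => 0) :
    (Submodule.span ℝ S : Set (HDiv Ω)) ⊆ T.conservative fun _ => 0 := fun q hq =>
  mem_conservative.2 fun K => by
    have hle : Submodule.span ℝ S ≤ LinearMap.ker (divIntegral (T := T) K) :=
      Submodule.span_le.2 fun p hp => by simpa using mem_conservative.1 (h hp) K
    rw [integral_zero]
    exact hle hq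

theorem reducedFluxSpace_subset_conservative_zero (hd : 0 < d) (hΩ : IsOpen Ω)
    {o : T.Orientation} {ν : ℝ} {f : Space d → ℝ} {n : ℕ} {s : Fin n → Space d → ℝ}
    {us : Fin n → T.DGSpace} (hus : ∀ i, T.IsGalerkinSolution o ν (s i) f ⊤ (us i)) {tf : HDiv Ω}
    (htf : tf ∈ T.conservative f) :
    (T.reducedFluxSpace o ν s us tf : Set (HDiv Ω)) ⊆ T.conservative fun _ => 0 :=
  span_subset_conservative_zero <| Set.range_subset_iff.2 fun i =>
    sub_mem_conservative_zero ((hus i).fluxReconstruction_mem_conservative hd hΩ) htf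

instance finiteDimensional_reducedFluxSpace (o : T.Orientation) (ν : ℝ) {n : ℕ}
    (s : Fin n → Space d → ℝ) (us : Fin n → T.DGSpace) (tf : HDiv Ω) :
    FiniteDimensional ℝ (T.reducedFluxSpace o ν s us tf) :=
  FiniteDimensional.span_of_finite ℝ (Set.finite_range _)

end Conservation

end Mesh

section Trace

variable {d : ℕ} {K : Finset (Space d)} {x : Space d}

theorem norm_average_le {α E : Type*} [MeasurableSpace α] [NormedAddCommGroup E] [NormedSpace ℝ E]
    {μ : Measure α} [IsFiniteMeasure μ] {g : α → E} {C : ℝ} (hC : 0 ≤ C)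
    (hg : ∀ᵐ y ∂μ, ‖g y‖ ≤ C) : ‖⨍ y, g y ∂μ‖ ≤ C := by
  rw [average_eq, norm_smul, norm_inv, Real.norm_of_nonneg measureReal_nonneg]
  refine inv_mul_le_of_le_mul₀ measureReal_nonneg hC ?_
  rw [mul_comm]
  exact norm_integral_le_of_norm_le_const hg

theorem HasTraceAt.trace_eq {s : Space d → ℝ} {c : ℝ} (h : HasTraceAt K s x c) :
    trace K s x = c :=
  h.limUnder_eq

theorem HasTraceAt.congr_ae {s s' : Space d → ℝ} {c : ℝ} (h : HasTraceAt K s x c)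
    (hs : s =ᵐ[volume.restrict (cell K)] s') : HasTraceAt K s' x c :=
  h.congr fun _ => average_congr (ae_restrict_of_ae_restrict_of_subset Set.inter_subset_right hs)

theorem HasTraceAt.norm_le {s : Space d → ℝ} {c C : ℝ} (h : HasTraceAt K s x c) (hC : 0 ≤ C)
    (hs : ∀ᵐ y ∂(volume.restrict (cell K)), ‖s y‖ ≤ C) : ‖c‖ ≤ C := by
  have := isFiniteMeasure_restrict_cell K
  refine le_of_tendsto h.norm (Eventually.of_forall fun r => ?_)
  have : IsFiniteMeasure (volume.restrict (Metric.ball x r ∩ cell K)) :=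
    isFiniteMeasure_of_le _ (Measure.restrict_mono_set _ Set.inter_subset_right)
  exact norm_average_le hC (ae_restrict_of_ae_restrict_of_subset Set.inter_subset_right hs)

theorem HasTraceAt.sum {ι : Type*} [Fintype ι] {s : ι → Space d → ℝ} {c : ι → ℝ}
    (h : ∀ i, HasTraceAt K (s i) x (c i)) (hs : ∀ i, IntegrableOn (s i) (cell K)) (θ : ι → ℝ) :
    HasTraceAt K (fun y => ∑ i, θ i * s i y) x (∑ i, θ i * c i) := by
  refine (tendsto_finsetSum Finset.univ fun i _ => (h i).const_mul (θ i)).congr fun r => ?_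
  simp only [setAverage_eq, smul_eq_mul]
  rw [integral_finsetSum _ fun i _ => ((hs i).mono_set Set.inter_subset_right).const_mul _,
    Finset.mul_sum]
  simp only [integral_const_mul, mul_left_comm]

theorem stronglyMeasurable_setIntegral_ball {s : Space d → ℝ} (hs : Measurable s)
    (A : Set (Space d)) (r : ℝ) :
    StronglyMeasurable fun x => ∫ y in Metric.ball x r ∩ A, s y := by
  have hU : MeasurableSet {p : Space d × Space d | dist p.2 p.1 < r} :=
    measurableSet_lt (by fun_prop) measurable_const
  have hind : ∀ x, ∫ y in Metric.ball x r ∩ A, s y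
      = ∫ y in A, {p : Space d × Space d | dist p.2 p.1 < r}.indicator
        (fun p => s p.2) (x, y) := fun x => by
    rw [← Measure.restrict_restrict Metric.isOpen_ball.measurableSet,
      ← integral_indicator Metric.isOpen_ball.measurableSet]
    rfl
  simp only [hind]
  exact ((hs.comp measurable_snd).indicator hU).stronglyMeasurable.integral_prod_right'

theorem stronglyMeasurable_setAverage_ball {s : Space d → ℝ} (hs : Measurable s)
    (A : Set (Space d)) (r : ℝ) :
    StronglyMeasurable fun x => ⨍ y in Metric.ball x r ∩ A, s y := by
  have hvol := stronglyMeasurable_setIntegral_ball (measurable_const (a := (1 : ℝ))) A r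
  simp only [setIntegral_const, smul_eq_mul, mul_one] at hvol
  simp only [setAverage_eq]
  exact (hvol.measurable.inv.mul
    (stronglyMeasurable_setIntegral_ball hs A r).measurable).stronglyMeasurable

end Trace

namespace Mesh

variable {d : ℕ} {Ω : Set (Space d)} {T : Mesh Ω}

section Coefficient

variable {s : Space d → ℝ} {Γ : T.faces} {K : T.cells}

theorem IsCoefficient.integrableOn_cell (hs : T.IsCoefficient s) (K : T.cells) :
    IntegrableOn s (cell K.1) := by
  have := isFiniteMeasure_restrict_cell K.1
  exact (hs.memLp.mono_measure (Measure.restrict_mono_set _ (T.cell_subset _ K.2))).integrable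
    le_top

theorem IsCoefficient.hasTraceAt (hs : T.IsCoefficient s) (hK : K ∈ T.adjacent Γ) :
    ∀ᵐ x ∂(surface Γ.1), HasTraceAt K.1 s x (trace K.1 s x) := by
  filter_upwards [hs.hasTrace Γ K hK] with x ⟨c, hc⟩
  rwa [hc.trace_eq]

theorem IsCoefficient.aestronglyMeasurable_trace (hs : T.IsCoefficient s)
    (hK : K ∈ T.adjacent Γ) : AEStronglyMeasurable (trace K.1 s) (surface Γ.1) := by
  have hmeas := (hs.integrableOn_cell K).aestronglyMeasurable
  have hradius : Tendsto (fun k : ℕ => 1 / ((k : ℝ) + 1)) atTop (𝓝[>] 0) :=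
    tendsto_nhdsWithin_iff.2 ⟨tendsto_one_div_add_atTop_nhds_zero_nat,
      Eventually.of_forall fun k => Set.mem_Ioi.2 (by positivity)⟩
  refine aestronglyMeasurable_of_tendsto_ae atTop
    (f := fun (k : ℕ) x => ⨍ y in Metric.ball x (1 / ((k : ℝ) + 1)) ∩ cell K.1, hmeas.mk s y)
    (fun k => (stronglyMeasurable_setAverage_ball hmeas.stronglyMeasurable_mk.measurable _
      _).aestronglyMeasurable) ?_
  filter_upwards [hs.hasTraceAt hK] with x hx
  exact (hx.congr_ae hmeas.ae_eq_mk).comp hradius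

theorem IsCoefficient.exists_trace_bound (hs : T.IsCoefficient s) (hK : K ∈ T.adjacent Γ) :
    ∃ C, ∀ᵐ x ∂(surface Γ.1), ‖trace K.1 s x‖ ≤ C := by
  have hbound : ∀ᵐ x ∂(volume.restrict Ω), ‖s x‖ ≤ (eLpNorm s ⊤ (volume.restrict Ω)).toReal := by
    filter_upwards [ae_le_eLpNormEssSup (f := s) (μ := volume.restrict Ω)] with x hx
    rw [← toReal_enorm, eLpNorm_exponent_top]
    exact ENNReal.toReal_mono (eLpNorm_exponent_top (f := s) ▸ hs.memLp.2.ne) hx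
  exact ⟨_, (hs.hasTraceAt hK).mono fun x hx =>
    hx.norm_le ENNReal.toReal_nonneg (ae_restrict_cell hbound K)⟩

theorem IsCoefficient.integrable_trace_mul (hs : T.IsCoefficient s) (hK : K ∈ T.adjacent Γ)
    {g : Space d → ℝ} (hg : Continuous g) :
    Integrable (fun x => trace K.1 s x * g x) (surface Γ.1) := by
  obtain ⟨C, hC⟩ := hs.exists_trace_bound hK
  exact (integrable_surface Γ hg).bdd_mul (hs.aestronglyMeasurable_trace hK) hC

theorem IsCoefficient.trace_sum {ι : Type*} [Fintype ι] {τ : ι → Space d → ℝ}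
    (hτ : ∀ i, T.IsCoefficient (τ i)) {θ : ι → ℝ}
    (hsum : ∀ᵐ x ∂(volume.restrict Ω), s x = ∑ i, θ i * τ i x) (hK : K ∈ T.adjacent Γ) :
    ∀ᵐ x ∂(surface Γ.1), trace K.1 s x = ∑ i, θ i * trace K.1 (τ i) x := by
  filter_upwards [ae_all_iff.2 fun i => (hτ i).hasTraceAt hK] with x hx
  refine ((HasTraceAt.sum hx (fun i => (hτ i).integrableOn_cell K) θ).congr_ae ?_).trace_eq
  exact (ae_restrict_cell hsum K).mono fun _ hy => hy.symm

end Coefficient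

section BilinearForm

variable (o : T.Orientation)

/-- The gradient on the element `K` as a linear map on `V_h`. -/
def cellGrad (K : T.cells) : T.DGSpace →ₗ[ℝ] Space d where
  toFun v := affGrad (v K)
  map_add' u v := affGrad_add (u K) (v K)
  map_smul' r v := affGrad_smul r (v K)

/-- The jump over `Γ` as a linear map on `V_h`, with values in the functions on all of `ℝ^d`. -/
def jumpMap (Γ : T.faces) : T.DGSpace →ₗ[ℝ] C(Space d, ℝ) where
  toFun v := ⟨T.jumpAt o v Γ, by
    have hcont : ∀ K : T.cells, Continuous (v K) := fun K => (v K).continuous_of_finiteDimensional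
    unfold jumpAt jump
    fun_prop⟩
  map_add' u v := by
    ext x
    simp only [jumpAt, jump, Pi.add_apply, AffineMap.coe_add, Finset.sum_add_distrib,
      ContinuousMap.add_apply, ContinuousMap.coe_mk]
    ring
  map_smul' r v := by
    ext x
    simp only [jumpAt, jump, Pi.smul_apply, AffineMap.coe_smul, smul_eq_mul, ← Finset.mul_sum,
      RingHom.id_apply, ContinuousMap.smul_apply, ContinuousMap.coe_mk]
    ring

/-- The `L²(Γ)` inner product of continuous functions. -/
def surfaceInner (Γ : T.faces) : C(Space d, ℝ) →ₗ[ℝ] C(Space d, ℝ) →ₗ[ℝ] ℝ :=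
  have hint (g h : C(Space d, ℝ)) := integrable_surface Γ (g.continuous.mul h.continuous)
  LinearMap.mk₂ ℝ (fun g h => ∫ x, g x * h x ∂(surface Γ.1))
    (fun g g' h => by
      simp only [ContinuousMap.add_apply, add_mul]
      exact integral_add (hint g h) (hint g' h))
    (fun r g h => by
      simp only [ContinuousMap.smul_apply, smul_eq_mul, mul_assoc, integral_const_mul])
    (fun g h h' => by
      simp only [ContinuousMap.add_apply, mul_add]
      exact integral_add (hint g h) (hint g h'))
    (fun r g h => by
      simp only [ContinuousMap.smul_apply, smul_eq_mul, mul_left_comm _ r, integral_const_mul])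

theorem avgFlux_add (s : Space d → ℝ) (u v : T.DGSpace) (Γ : T.faces) (x : Space d) :
    T.avgFlux o s (u + v) Γ x = T.avgFlux o s u Γ x + T.avgFlux o s v Γ x := by
  simp only [avgFlux, avg, Pi.add_apply, affGrad_add, inner_add_left, mul_add,
    Finset.sum_add_distrib]

theorem avgFlux_smul (s : Space d → ℝ) (r : ℝ) (v : T.DGSpace) (Γ : T.faces) (x : Space d) :
    T.avgFlux o s (r • v) Γ x = r * T.avgFlux o s v Γ x := by
  simp only [avgFlux, avg, Pi.smul_apply, affGrad_smul, real_inner_smul_left, Finset.mul_sum,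
    mul_left_comm]

variable {s : Space d → ℝ} (hs : T.IsCoefficient s)

include hs in
theorem IsCoefficient.integrable_avgFlux_mul (v : T.DGSpace) (Γ : T.faces) {g : Space d → ℝ}
    (hg : Continuous g) : Integrable (fun x => T.avgFlux o s v Γ x * g x) (surface Γ.1) := by
  simp only [avgFlux, avg, mul_assoc, Finset.sum_mul]
  refine (integrable_finsetSum _ fun K hK => ?_).const_mul _
  simp only [mul_comm (inner ℝ _ _), ← mul_assoc]
  exact (hs.integrable_trace_mul hK hg).mul_const _

/-- `∫_Γ ⟨(s ∇u) · n⟩ g` as a bilinear form in `u` and `g`. -/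
def fluxForm (Γ : T.faces) : T.DGSpace →ₗ[ℝ] C(Space d, ℝ) →ₗ[ℝ] ℝ :=
  have hint (u : T.DGSpace) (g : C(Space d, ℝ)) := hs.integrable_avgFlux_mul o u Γ g.continuous
  LinearMap.mk₂ ℝ (fun u g => ∫ x, T.avgFlux o s u Γ x * g x ∂(surface Γ.1))
    (fun u v g => by
      simp only [avgFlux_add, add_mul]
      exact integral_add (hint u g) (hint v g))
    (fun r u g => by simp only [avgFlux_smul, smul_eq_mul, mul_assoc, integral_const_mul])
    (fun u g h => by
      simp only [ContinuousMap.add_apply, mul_add]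
      exact integral_add (hint u g) (hint u h))
    (fun r u g => by
      simp only [ContinuousMap.smul_apply, smul_eq_mul, mul_left_comm _ r, integral_const_mul])

theorem fluxForm_apply (Γ : T.faces) (u : T.DGSpace) (g : C(Space d, ℝ)) :
    fluxForm o hs Γ u g = ∫ x, T.avgFlux o s u Γ x * g x ∂(surface Γ.1) :=
  rfl

/-- The penalty part of the bilinear form, which does not depend on the coefficient. -/
def penaltyForm (ν : ℝ) : T.DGSpace →ₗ[ℝ] T.DGSpace →ₗ[ℝ] ℝ :=
  ∑ Γ : T.faces, (ν / faceDiam Γ.1) • (surfaceInner Γ).compl₁₂ (jumpMap o Γ) (jumpMap o Γ)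

/-- The part of the bilinear form that depends on the coefficient. -/
def diffusionForm : T.DGSpace →ₗ[ℝ] T.DGSpace →ₗ[ℝ] ℝ :=
  ∑ K : T.cells, (∫ x in cell K.1, s x) • (innerₗ (Space d)).compl₁₂ (cellGrad K) (cellGrad K)
  - ∑ Γ : T.faces,
      ((fluxForm o hs Γ).compl₂ (jumpMap o Γ) + ((fluxForm o hs Γ).compl₂ (jumpMap o Γ)).flip)

theorem IsCoefficient.ipForm_eq (ν : ℝ) (u v : T.DGSpace) :
    T.ipForm o ν s u v = penaltyForm o ν u v + diffusionForm o hs u v := by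
  have hface : ∀ Γ : T.faces, ∫ x, (- T.avgFlux o s v Γ x * T.jumpAt o u Γ x
        - T.avgFlux o s u Γ x * T.jumpAt o v Γ x
        + ν / faceDiam Γ.1 * T.jumpAt o u Γ x * T.jumpAt o v Γ x) ∂(surface Γ.1)
      = ν / faceDiam Γ.1 * surfaceInner Γ (jumpMap o Γ u) (jumpMap o Γ v)
        - (fluxForm o hs Γ u (jumpMap o Γ v) + fluxForm o hs Γ v (jumpMap o Γ u)) := fun Γ => by
    have hflux (u v : T.DGSpace) := hs.integrable_avgFlux_mul o u Γ (jumpMap o Γ v).continuous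
    have hjump := integrable_surface Γ ((jumpMap o Γ u).continuous.mul (jumpMap o Γ v).continuous)
    refine Eq.trans (integral_congr_ae (ae_of_all _ fun x => ?_))
      ((integral_sub (hjump.const_mul (ν / faceDiam Γ.1)) ((hflux u v).add (hflux v u))).trans
        (congrArg₂ (· - ·) (integral_const_mul _ _) (integral_add (hflux u v) (hflux v u))))
    simp only [jumpMap, LinearMap.coe_mk, AddHom.coe_mk, ContinuousMap.coe_mk, Pi.add_apply,
      Pi.mul_apply]
    ring
  simp only [ipForm, hface, integral_mul_const, penaltyForm, diffusionForm, LinearMap.add_apply,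
    LinearMap.sub_apply, LinearMap.sum_apply, LinearMap.smul_apply, LinearMap.compl₁₂_apply,
    LinearMap.compl₂_apply, LinearMap.flip_apply, innerₗ_apply_apply, smul_eq_mul,
    Finset.sum_sub_distrib]
  change _ + (_ - _) = _ + (∑ K : T.cells, _ * inner ℝ (affGrad (u K)) (affGrad (v K)) - _)
  ring

end BilinearForm

section Separation

variable (o : T.Orientation) (ν : ℝ) {s : Space d → ℝ} (hs : T.IsCoefficient s)

/-- The part of the mean face fluxes that comes from the penalty. -/
def penaltyFlux : T.DGSpace →ₗ[ℝ] T.faces → ℝ :=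
  LinearMap.pi fun Γ => (ν / faceDiam Γ.1 / (surface Γ.1).real Set.univ) •
    (surfaceInner Γ).flip 1 ∘ₗ jumpMap o Γ

/-- The part of the mean face fluxes that depends on the coefficient. -/
def diffusionFlux : T.DGSpace →ₗ[ℝ] T.faces → ℝ :=
  LinearMap.pi fun Γ => -((surface Γ.1).real Set.univ)⁻¹ • (fluxForm o hs Γ).flip 1

theorem IsCoefficient.meanFlux_eq (v : T.DGSpace) :
    meanFlux o ν s v = penaltyFlux o ν v + diffusionFlux o hs v := by
  ext Γ
  have hflux := hs.integrable_avgFlux_mul o v Γ (continuous_const (y := (1 : ℝ)))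
  have hjump := integrable_surface Γ ((jumpMap o Γ v).continuous.mul
    (continuous_const (y := (1 : ℝ))))
  have hface : faceFlux o ν s v Γ = ν / faceDiam Γ.1 * surfaceInner Γ (jumpMap o Γ v) 1
      - fluxForm o hs Γ v 1 := by
    refine Eq.trans (integral_congr_ae (ae_of_all _ fun x => ?_))
      ((integral_sub (hjump.const_mul (ν / faceDiam Γ.1)) hflux).trans
        (congrArg (· - _) (integral_const_mul _ _)))
    simp only [jumpMap, LinearMap.coe_mk, AddHom.coe_mk, ContinuousMap.coe_mk, Pi.mul_apply]
    ring
  simp only [meanFlux, hface, penaltyFlux, diffusionFlux, Pi.add_apply, LinearMap.pi_apply,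
    LinearMap.smul_apply, LinearMap.comp_apply, LinearMap.flip_apply, smul_eq_mul]
  ring

variable {ι : Type*} [Fintype ι] {τ : ι → Space d → ℝ} (hτ : ∀ i, T.IsCoefficient (τ i))
  {θ : ι → ℝ} (hsum : ∀ᵐ x ∂(volume.restrict Ω), s x = ∑ i, θ i * τ i x)

include hτ hsum in
theorem IsCoefficient.avgFlux_sum (v : T.DGSpace) (Γ : T.faces) :
    ∀ᵐ x ∂(surface Γ.1), T.avgFlux o s v Γ x = ∑ i, θ i * T.avgFlux o (τ i) v Γ x := by
  have htrace : ∀ᵐ x ∂(surface Γ.1), ∀ K ∈ T.adjacent Γ,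
      trace K.1 s x = ∑ i, θ i * trace K.1 (τ i) x :=
    (Finset.eventually_all _).2 fun K hK => trace_sum hτ hsum hK
  filter_upwards [htrace] with x hx
  simp only [avgFlux, avg, Finset.mul_sum]
  rw [Finset.sum_comm]
  refine Finset.sum_congr rfl fun K hK => ?_
  rw [hx K hK, Finset.sum_mul, Finset.mul_sum]
  exact Finset.sum_congr rfl fun i _ => by ring

include hsum in
theorem fluxForm_eq_sum (Γ : T.faces) :
    fluxForm o hs Γ = ∑ i, θ i • fluxForm o (hτ i) Γ := by
  refine LinearMap.ext fun u => LinearMap.ext fun g => ?_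
  simp only [LinearMap.sum_apply, LinearMap.smul_apply, smul_eq_mul, fluxForm_apply,
    ← integral_const_mul]
  rw [← integral_finsetSum _ fun i _ =>
    ((hτ i).integrable_avgFlux_mul o u Γ g.continuous).const_mul (θ i)]
  refine integral_congr_ae ?_
  filter_upwards [IsCoefficient.avgFlux_sum o hτ hsum u Γ] with x hx
  simp only [hx, Finset.sum_mul, mul_assoc]

include hτ hsum in
theorem IsCoefficient.integral_cell_sum (K : T.cells) :
    ∫ x in cell K.1, s x = ∑ i, θ i * ∫ x in cell K.1, τ i x := by
  simp only [← integral_const_mul]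
  rw [← integral_finsetSum _ fun i _ => ((hτ i).integrableOn_cell K).const_mul (θ i)]
  exact integral_congr_ae (ae_restrict_cell hsum K)

include hsum in
theorem diffusionForm_eq_sum :
    diffusionForm o hs = ∑ i, θ i • diffusionForm o (hτ i) := by
  refine LinearMap.ext fun u => LinearMap.ext fun v => ?_
  simp only [diffusionForm, fluxForm_eq_sum o hs hτ hsum, IsCoefficient.integral_cell_sum hτ hsum,
    LinearMap.sub_apply, LinearMap.sum_apply, LinearMap.add_apply, LinearMap.smul_apply,
    LinearMap.compl₂_apply, LinearMap.flip_apply, smul_eq_mul, Finset.sum_mul, mul_sub,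
    Finset.sum_sub_distrib, Finset.mul_sum, mul_add, Finset.sum_add_distrib, mul_assoc]
  rw [Finset.sum_comm, Finset.sum_comm (s := (Finset.univ : Finset T.faces)),
    Finset.sum_comm (s := (Finset.univ : Finset T.faces))]

include hsum in
theorem diffusionFlux_eq_sum :
    diffusionFlux o hs = ∑ i, θ i • diffusionFlux o (hτ i) := by
  refine LinearMap.ext fun v => funext fun Γ => ?_
  simp only [diffusionFlux, fluxForm_eq_sum o hs hτ hsum, LinearMap.pi_apply, LinearMap.sum_apply,
    LinearMap.smul_apply, LinearMap.flip_apply, Finset.sum_apply, Pi.smul_apply, smul_eq_mul,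
    Finset.mul_sum, mul_left_comm]

include hs hsum in
theorem IsCoefficient.ipForm_separable (u v : T.DGSpace) :
    T.ipForm o ν s u v = penaltyForm o ν u v + ∑ i, θ i * diffusionForm o (hτ i) u v := by
  simp only [hs.ipForm_eq, diffusionForm_eq_sum o hs hτ hsum, LinearMap.sum_apply,
    LinearMap.smul_apply, smul_eq_mul]

include hs hsum in
theorem IsCoefficient.fluxReconstruction_separable (hd : 0 < d) (hΩ : IsOpen Ω) (v : T.DGSpace) :
    T.fluxReconstruction o ν s v = (rtLift o hd hΩ ∘ₗ penaltyFlux o ν) v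
      + ∑ i, θ i • (rtLift o hd hΩ ∘ₗ diffusionFlux o (hτ i)) v := by
  simp only [fluxReconstruction_eq_rtLift o ν s v hd hΩ, hs.meanFlux_eq,
    diffusionFlux_eq_sum o hs hτ hsum, LinearMap.sum_apply, LinearMap.smul_apply, map_add, map_sum,
    map_smul, LinearMap.comp_apply]

end Separation

end Mesh

section LinearSystem

variable {R V W ι κ : Type*} [CommRing R] [AddCommGroup V] [Module R V] [AddCommGroup W]
  [Module R W]

theorem of_mulVec_eq_apply_sum [Fintype ι] (B : V →ₗ[R] W →ₗ[R] R) (ψ : ι → V) (χ : κ → W)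
    (α : ι → R) :
    (Matrix.of fun i j => B (ψ j) (χ i)).mulVec α = fun i => B (∑ j, α j • ψ j) (χ i) := by
  ext i
  simp only [Matrix.mulVec, dotProduct, Matrix.of_apply, map_sum, map_smul, LinearMap.sum_apply,
    LinearMap.smul_apply, smul_eq_mul, mul_comm]

theorem of_sum_smul_apply {Ξ : Type*} [Fintype Ξ] (θ : Ξ → R) (B : Ξ → V →ₗ[R] W →ₗ[R] R)
    (ψ : ι → V) (χ : κ → W) :
    (Matrix.of fun i j => (∑ ξ, θ ξ • B ξ) (ψ j) (χ i))
      = ∑ ξ, θ ξ • Matrix.of fun i j => B ξ (ψ j) (χ i) := by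
  ext i j
  simp only [Matrix.of_apply, Matrix.sum_apply, Matrix.smul_apply, LinearMap.sum_apply,
    LinearMap.smul_apply]

theorem galerkin_span_iff [Fintype ι] (B : V →ₗ[R] V →ₗ[R] R) (ℓ : V →ₗ[R] R) {S : Submodule R V}
    {ψ : ι → V} (hψ : Submodule.span R (Set.range ψ) = S) (α : ι → R) :
    (∑ j, α j • ψ j ∈ S ∧ ∀ v ∈ S, B (∑ j, α j • ψ j) v = ℓ v)
      ↔ (Matrix.of fun i j => B (ψ j) (ψ i)).mulVec α = fun i => ℓ (ψ i) := by
  subst hψ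
  have hmem (i : ι) : ψ i ∈ Submodule.span R (Set.range ψ) := Submodule.subset_span ⟨i, rfl⟩
  rw [of_mulVec_eq_apply_sum, funext_iff]
  refine ⟨fun h i => h.2 _ (hmem i),
    fun h => ⟨Submodule.sum_mem _ fun j _ => Submodule.smul_mem _ _ (hmem j), ?_⟩⟩
  exact Submodule.span_le (p := LinearMap.eqLocus (B (∑ j, α j • ψ j)) ℓ).2
    (Set.range_subset_iff.2 h)

end LinearSystem

section Projection

variable {E : Type*} [NormedAddCommGroup E] [InnerProductSpace ℝ E] {Q : Submodule ℝ E}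

theorem existsUnique_forall_inner_eq [FiniteDimensional ℝ Q] (z : E) :
    ∃! p, p ∈ Q ∧ ∀ q ∈ Q, inner ℝ p q = inner ℝ z q := by
  refine ⟨Q.starProjection z, ⟨Q.starProjection_apply_mem z, fun q hq => ?_⟩, ?_⟩
  · rw [eq_comm, ← sub_eq_zero, ← inner_sub_left]
    exact (Submodule.mem_orthogonal' _ _).1 (Q.sub_starProjection_mem_orthogonal z) q hq
  · rintro p ⟨hp, hpz⟩
    refine (Submodule.eq_starProjection_of_mem_of_inner_eq_zero hp fun q hq => ?_).symm
    rw [inner_sub_left, hpz q hq, sub_self]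

theorem orthogonal_separable_iff {V ι κ Ξ : Type*} [AddCommGroup V] [Module ℝ V] [Fintype ι]
    [Fintype κ] [Fintype Ξ] {χ : κ → E} (hχ : Submodule.span ℝ (Set.range χ) = Q)
    (R₀ : V →ₗ[ℝ] E) (R : Ξ → V →ₗ[ℝ] E) (θ : Ξ → ℝ) (t : E) (ψ : ι → V) (α : ι → ℝ)
    (β : κ → ℝ) {r : E} (hr : r = R₀ (∑ j, α j • ψ j) + ∑ ξ, θ ξ • R ξ (∑ j, α j • ψ j)) :
    (∑ j, β j • χ j ∈ Q ∧ ∀ q ∈ Q, inner ℝ (∑ j, β j • χ j) q = inner ℝ (r - t) q)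
      ↔ (Matrix.of fun i j => inner ℝ (χ j) (χ i)).mulVec β
        = ((Matrix.of fun i j => inner ℝ (R₀ (ψ j)) (χ i))
          + ∑ ξ, θ ξ • Matrix.of fun i j => inner ℝ (R ξ (ψ j)) (χ i)).mulVec α
          - fun i => inner ℝ t (χ i) := by
  have hmul (L : V →ₗ[ℝ] E) := of_mulVec_eq_apply_sum (innerₗ E ∘ₗ L) ψ χ α
  simp only [LinearMap.comp_apply, innerₗ_apply_apply] at hmul
  rw [Matrix.add_mulVec, Matrix.sum_mulVec]
  simp only [Matrix.smul_mulVec, hmul]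
  refine (galerkin_span_iff (innerₗ E) (innerₗ E (r - t)) hχ β).trans
    (Eq.congr_right (funext fun i => ?_))
  simp only [hr, innerₗ_apply_apply, inner_sub_left, inner_add_left, sum_inner,
    real_inner_smul_left, Pi.sub_apply, Pi.add_apply, Finset.sum_apply, Pi.smul_apply, smul_eq_mul]

theorem existsUnique_isProjection {d : ℕ} {Ω : Set (Space d)} (Q : Submodule ℝ (HDiv Ω))
    [FiniteDimensional ℝ Q] (z : HDiv Ω) : ∃! p, IsProjection Q z p :=
  existsUnique_forall_inner_eq (E := HDiv Ω) z

end Projection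

namespace Mesh

variable {d : ℕ} {Ω : Set (Space d)} {T : Mesh Ω} {f : Space d → ℝ}

section ReducedSystem

/-- The load as a linear functional on `V_h`. -/
def loadMap (hf : MemLp f 2 (volume.restrict Ω)) : T.DGSpace →ₗ[ℝ] ℝ :=
  have hint (v : T.DGSpace) (K : T.cells) : IntegrableOn (fun x => f x * v K x) (cell K.1) :=
    (hf.mono_measure (Measure.restrict_mono_set _ (T.cell_subset _ K.2))).integrable_mul (q := 2)
      (memLp_cell _ (v K).continuous_of_finiteDimensional 2)
  { toFun := T.load f
    map_add' := fun u v => by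
      simp only [load, Pi.add_apply, AffineMap.coe_add, mul_add, ← Finset.sum_add_distrib]
      exact Finset.sum_congr rfl fun K _ => integral_add (hint u K) (hint v K)
    map_smul' := fun r v => by
      simp only [load, Pi.smul_apply, AffineMap.coe_smul, smul_eq_mul, RingHom.id_apply,
        Finset.mul_sum, mul_left_comm _ r, integral_const_mul] }

variable {o : T.Orientation} {ν : ℝ} {s : Space d → ℝ} (hf : MemLp f 2 (volume.restrict Ω))
  {V : Submodule ℝ T.DGSpace} {ι Ξ : Type*} [Fintype ι] [Fintype Ξ] {ψ : ι → T.DGSpace}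
  (hψ : Submodule.span ℝ (Set.range ψ) = V) (α : ι → ℝ) {θ : Ξ → ℝ}
  {a₀ : T.DGSpace →ₗ[ℝ] T.DGSpace →ₗ[ℝ] ℝ} {a : Ξ → T.DGSpace →ₗ[ℝ] T.DGSpace →ₗ[ℝ] ℝ}

include hf hψ

theorem isGalerkinSolution_span_iff {B : T.DGSpace →ₗ[ℝ] T.DGSpace →ₗ[ℝ] ℝ}
    (hB : ∀ u v, T.ipForm o ν s u v = B u v) :
    T.IsGalerkinSolution o ν s f V (∑ j, α j • ψ j)
      ↔ (Matrix.of fun i j => B (ψ j) (ψ i)).mulVec α = fun i => T.load f (ψ i) := by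
  simp only [IsGalerkinSolution, hB]
  exact galerkin_span_iff B (loadMap hf) hψ α

theorem isGalerkinSolution_separable_iff (ha : ∀ u v, T.ipForm o ν s u v = ∑ ξ, θ ξ * a ξ u v) :
    T.IsGalerkinSolution o ν s f V (∑ j, α j • ψ j)
      ↔ (∑ ξ, θ ξ • Matrix.of fun i j => a ξ (ψ j) (ψ i)).mulVec α
        = fun i => T.load f (ψ i) := by
  rw [← of_sum_smul_apply]
  exact isGalerkinSolution_span_iff hf hψ α fun u v => by
    simp only [ha, LinearMap.sum_apply, LinearMap.smul_apply, smul_eq_mul]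

theorem isGalerkinSolution_affine_separable_iff
    (ha : ∀ u v, T.ipForm o ν s u v = a₀ u v + ∑ ξ, θ ξ * a ξ u v) :
    T.IsGalerkinSolution o ν s f V (∑ j, α j • ψ j)
      ↔ ((Matrix.of fun i j => a₀ (ψ j) (ψ i))
          + ∑ ξ, θ ξ • Matrix.of fun i j => a ξ (ψ j) (ψ i)).mulVec α
        = fun i => T.load f (ψ i) := by
  rw [← of_sum_smul_apply, Matrix.of_add_of]
  exact isGalerkinSolution_span_iff (B := a₀ + ∑ ξ, θ ξ • a ξ) hf hψ α fun u v => by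
    simp only [ha, LinearMap.add_apply, LinearMap.sum_apply, LinearMap.smul_apply, smul_eq_mul]

end ReducedSystem

end Mesh

end IPDG

end

open IPDG in
theorem mainTheorem1_general {d : ℕ} (hd : 2 ≤ d)
    (Ω : Set (Space d)) (hΩ : IsOpen Ω) (T : Mesh Ω) (o : T.Orientation)
    {M : Type*} (P : Set M) (σ : M → Space d → ℝ) (hσ : ∀ μ ∈ P, T.IsCoefficient (σ μ))
    (f : Space d → ℝ) (hf : MemLp f 2 (volume.restrict Ω)) (ν : ℝ)
    (uf : T.DGSpace) (huf : T.IsGalerkinSolution o ν (fun _ => 1) f ⊤ uf)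
    (n : ℕ) (μs : Fin n → P)
    (us : Fin n → T.DGSpace) (hus : ∀ i, T.IsGalerkinSolution o ν (σ (μs i)) f ⊤ (us i))
    (tf : HDiv Ω) (htf : tf = T.sourceFlux o ν uf)
    (Vn : Submodule ℝ T.DGSpace) (hVn : Vn = T.reducedSpace us)
    (Qn : Submodule ℝ (HDiv Ω))
    (hQn : Qn = T.reducedFluxSpace o ν (fun i => σ (μs i)) us tf) :
    (∀ v, ∃! q, T.IsFluxReconstruction o ν (fun _ => 1) v q) ∧
    (∀ μ ∈ P, ∀ v, ∃! q, T.IsFluxReconstruction o ν (σ μ) v q) ∧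
    tf ∈ T.conservative f ∧
    (∀ μ ∈ P, ∀ u, T.IsGalerkinSolution o ν (σ μ) f ⊤ u →
      T.fluxReconstruction o ν (σ μ) u ∈ T.conservative f) ∧
    (Qn : Set (HDiv Ω)) ⊆ T.conservative (fun _ => 0) ∧
    (∀ μ ∈ P, ∀ v ∈ Vn,
      ∃! π, IsProjection Qn (T.fluxReconstruction o ν (σ μ) v - tf) π) ∧
    (∀ μ ∈ P, ∀ u, T.IsGalerkinSolution o ν (σ μ) f Vn u →
      ∀ π, IsProjection Qn (T.fluxReconstruction o ν (σ μ) u - tf) π →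
        π + tf ∈ T.conservative f) ∧
    (∀ (Ξ : ℕ) (θ : Fin Ξ → M → ℝ)
      (a : Fin Ξ → T.DGSpace →ₗ[ℝ] T.DGSpace →ₗ[ℝ] ℝ),
      (∀ μ ∈ P, ∀ u v, T.ipForm o ν (σ μ) u v = ∑ ξ, θ ξ μ * a ξ u v) →
      ∀ (N : ℕ) (ψ : Fin N → T.DGSpace), Submodule.span ℝ (Set.range ψ) = Vn →
      ∀ μ ∈ P, ∀ α : Fin N → ℝ,
        T.IsGalerkinSolution o ν (σ μ) f Vn (∑ j, α j • ψ j) ↔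
          (∑ ξ, θ ξ μ • Matrix.of fun i j => a ξ (ψ j) (ψ i)).mulVec α
            = fun i => T.load f (ψ i)) ∧
    (∀ (Ξ : ℕ) (θ : Fin Ξ → M → ℝ) (τ : Fin Ξ → Space d → ℝ),
      (∀ ξ, T.IsCoefficient (τ ξ)) →
      (∀ μ ∈ P, ∀ᵐ x ∂(volume.restrict Ω), σ μ x = ∑ ξ, θ ξ μ * τ ξ x) →
      ∃ (a₀ : T.DGSpace →ₗ[ℝ] T.DGSpace →ₗ[ℝ] ℝ)
        (a : Fin Ξ → T.DGSpace →ₗ[ℝ] T.DGSpace →ₗ[ℝ] ℝ)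
        (R₀ : T.DGSpace →ₗ[ℝ] HDiv Ω) (R' : Fin Ξ → T.DGSpace →ₗ[ℝ] HDiv Ω),
        (∀ μ ∈ P, ∀ u v, T.ipForm o ν (σ μ) u v = a₀ u v + ∑ ξ, θ ξ μ * a ξ u v) ∧
        (∀ μ ∈ P, ∀ v, T.fluxReconstruction o ν (σ μ) v = R₀ v + ∑ ξ, θ ξ μ • R' ξ v) ∧
        ∀ (N N' : ℕ) (ψ : Fin N → T.DGSpace) (χ : Fin N' → HDiv Ω),
          Submodule.span ℝ (Set.range ψ) = Vn → Submodule.span ℝ (Set.range χ) = Qn →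
          ∀ μ ∈ P, ∀ (α : Fin N → ℝ) (β : Fin N' → ℝ),
            (T.IsGalerkinSolution o ν (σ μ) f Vn (∑ j, α j • ψ j) ↔
              ((Matrix.of fun i j => a₀ (ψ j) (ψ i))
                + ∑ ξ, θ ξ μ • Matrix.of fun i j => a ξ (ψ j) (ψ i)).mulVec α
                = fun i => T.load f (ψ i)) ∧
            (IsProjection Qn (T.fluxReconstruction o ν (σ μ) (∑ j, α j • ψ j) - tf)
                (∑ j, β j • χ j) ↔
              (Matrix.of fun i j => inner ℝ (χ j) (χ i)).mulVec β
                = ((Matrix.of fun i j => inner ℝ (R₀ (ψ j)) (χ i))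
                  + ∑ ξ, θ ξ μ • Matrix.of fun i j => inner ℝ (R' ξ (ψ j)) (χ i)).mulVec α
                  - fun i => inner ℝ tf (χ i))) := by
  have hd0 : 0 < d := by omega
  subst hVn hQn
  have htc : tf ∈ T.conservative f :=
    htf ▸ Mesh.IsGalerkinSolution.fluxReconstruction_mem_conservative hd0 hΩ huf
  have hQ := Mesh.reducedFluxSpace_subset_conservative_zero hd0 hΩ hus htc
  refine ⟨fun v => Mesh.existsUnique_isFluxReconstruction o ν _ v hd0 hΩ,
    fun μ _ v => Mesh.existsUnique_isFluxReconstruction o ν _ v hd0 hΩ, htc,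
    fun μ _ u hu => hu.fluxReconstruction_mem_conservative hd0 hΩ, hQ,
    fun μ _ v _ => existsUnique_isProjection _ _,
    fun μ _ u _ π hπ => Mesh.add_mem_conservative (hQ hπ.1) htc,
    fun Ξ θ a ha N ψ hψ μ hμ α => Mesh.isGalerkinSolution_separable_iff hf hψ α (ha μ hμ), ?_⟩
  intro Ξ θ τ hτ hsum
  have ha (μ) (hμ : μ ∈ P) := (hσ μ hμ).ipForm_separable o ν hτ (hsum μ hμ)
  have hR (μ) (hμ : μ ∈ P) := (hσ μ hμ).fluxReconstruction_separable o ν hτ (hsum μ hμ) hd0 hΩ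
  exact ⟨_, _, _, _, ha, hR, fun N N' ψ χ hψ hχ μ hμ α β =>
    ⟨Mesh.isGalerkinSolution_affine_separable_iff hf hψ α (ha μ hμ),
      orthogonal_separable_iff (E := HDiv Ω) hχ _ _ _ tf ψ α β (hR μ hμ _)⟩⟩

open IPDG in
theorem mainTheorem1 {d p : ℕ} (hd : d = 2 ∨ d = 3)
    -- the domain and its grid
    (Ω : Set (Space d)) (hΩ : IsOpen Ω) (T : Mesh Ω) (o : T.Orientation)
    -- the parametric problem
    (P : Set (EuclideanSpace ℝ (Fin p))) (hP : IsCompact P)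
    (σ : EuclideanSpace ℝ (Fin p) → Space d → ℝ)
    (hσ : ∀ μ ∈ P, T.IsCoefficient (σ μ))
    (hσpos : ∀ μ ∈ P, ∃ c > 0, ∀ᵐ x ∂(volume.restrict Ω), c ≤ σ μ x)
    (f : Space d → ℝ) (hf : MemLp f 2 (volume.restrict Ω))
    (ν : ℝ) (hν : 0 < ν)
    -- the IPDG solution for the coefficient `1`, and the snapshots `u_{h, μ_i}`
    (uf : T.DGSpace) (huf : T.IsGalerkinSolution o ν (fun _ => 1) f ⊤ uf)
    (n : ℕ) (μs : Fin n → EuclideanSpace ℝ (Fin p)) (hμs : ∀ i, μs i ∈ P)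
    (us : Fin n → T.DGSpace) (hus : ∀ i, T.IsGalerkinSolution o ν (σ (μs i)) f ⊤ (us i))
    -- the flux `t_f` and the reduced spaces
    (tf : HDiv Ω) (htf : tf = T.sourceFlux o ν uf)
    (Vn : Submodule ℝ T.DGSpace) (hVn : Vn = T.reducedSpace us)
    (Qn : Submodule ℝ (HDiv Ω))
    (hQn : Qn = T.reducedFluxSpace o ν (fun i => σ (μs i)) us tf) :
    -- the flux reconstruction is well defined
    (∀ v, ∃! q, T.IsFluxReconstruction o ν (fun _ => 1) v q) ∧
    (∀ μ ∈ P, ∀ v, ∃! q, T.IsFluxReconstruction o ν (σ μ) v q) ∧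
    -- reconstructions of IPDG solutions are locally conservative
    tf ∈ T.conservative f ∧
    (∀ μ ∈ P, ∀ u, T.IsGalerkinSolution o ν (σ μ) f ⊤ u →
      T.fluxReconstruction o ν (σ μ) u ∈ T.conservative f) ∧
    (Qn : Set (HDiv Ω)) ⊆ T.conservative (fun _ => 0) ∧
    -- the reduced projection is well defined
    (∀ μ ∈ P, ∀ v ∈ Vn,
      ∃! π, IsProjection Qn (T.fluxReconstruction o ν (σ μ) v - tf) π) ∧
    -- the reduced flux is locally conservative
    (∀ μ ∈ P, ∀ u, T.IsGalerkinSolution o ν (σ μ) f Vn u →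
      ∀ π, IsProjection Qn (T.fluxReconstruction o ν (σ μ) u - tf) π →
        π + tf ∈ T.conservative f) ∧
    -- if the bilinear form is separable, so is the reduced system for `u_{n, μ}`
    (∀ (Ξ : ℕ) (θ : Fin Ξ → EuclideanSpace ℝ (Fin p) → ℝ)
      (a : Fin Ξ → T.DGSpace →ₗ[ℝ] T.DGSpace →ₗ[ℝ] ℝ),
      (∀ μ ∈ P, ∀ u v, T.ipForm o ν (σ μ) u v = ∑ ξ, θ ξ μ * a ξ u v) →
      ∀ (N : ℕ) (ψ : Fin N → T.DGSpace), Submodule.span ℝ (Set.range ψ) = Vn →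
      ∀ μ ∈ P, ∀ α : Fin N → ℝ,
        T.IsGalerkinSolution o ν (σ μ) f Vn (∑ j, α j • ψ j) ↔
          (∑ ξ, θ ξ μ • Matrix.of fun i j => a ξ (ψ j) (ψ i)).mulVec α
            = fun i => T.load f (ψ i)) ∧
    -- if the coefficient is separable, so are the bilinear form, the flux reconstruction and
    -- the reduced systems for `u_{n, μ}` and for its reduced projection
    (∀ (Ξ : ℕ) (θ : Fin Ξ → EuclideanSpace ℝ (Fin p) → ℝ) (τ : Fin Ξ → Space d → ℝ),
      (∀ ξ, T.IsCoefficient (τ ξ)) →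
      (∀ μ ∈ P, ∀ᵐ x ∂(volume.restrict Ω), σ μ x = ∑ ξ, θ ξ μ * τ ξ x) →
      ∃ (a₀ : T.DGSpace →ₗ[ℝ] T.DGSpace →ₗ[ℝ] ℝ)
        (a : Fin Ξ → T.DGSpace →ₗ[ℝ] T.DGSpace →ₗ[ℝ] ℝ)
        (R₀ : T.DGSpace →ₗ[ℝ] HDiv Ω) (R' : Fin Ξ → T.DGSpace →ₗ[ℝ] HDiv Ω),
        (∀ μ ∈ P, ∀ u v, T.ipForm o ν (σ μ) u v = a₀ u v + ∑ ξ, θ ξ μ * a ξ u v) ∧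
        (∀ μ ∈ P, ∀ v, T.fluxReconstruction o ν (σ μ) v = R₀ v + ∑ ξ, θ ξ μ • R' ξ v) ∧
        ∀ (N M : ℕ) (ψ : Fin N → T.DGSpace) (χ : Fin M → HDiv Ω),
          Submodule.span ℝ (Set.range ψ) = Vn → Submodule.span ℝ (Set.range χ) = Qn →
          ∀ μ ∈ P, ∀ (α : Fin N → ℝ) (β : Fin M → ℝ),
            (T.IsGalerkinSolution o ν (σ μ) f Vn (∑ j, α j • ψ j) ↔
              ((Matrix.of fun i j => a₀ (ψ j) (ψ i))
                + ∑ ξ, θ ξ μ • Matrix.of fun i j => a ξ (ψ j) (ψ i)).mulVec α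
                = fun i => T.load f (ψ i)) ∧
            (IsProjection Qn (T.fluxReconstruction o ν (σ μ) (∑ j, α j • ψ j) - tf)
                (∑ j, β j • χ j) ↔
              (Matrix.of fun i j => inner ℝ (χ j) (χ i)).mulVec β
                = ((Matrix.of fun i j => inner ℝ (R₀ (ψ j)) (χ i))
                  + ∑ ξ, θ ξ μ • Matrix.of fun i j => inner ℝ (R' ξ (ψ j)) (χ i)).mulVec α
                  - fun i => inner ℝ tf (χ i))) :=
  mainTheorem1_general (by omega) Ω hΩ T o P σ hσ f hf ν uf huf n (fun i => ⟨μs i, hμs i⟩) us hus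
    tf htf Vn hVn Qn hQn
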